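/- **Theorem (special orthogonal group as product of two Grassmannians).** For integers $0 \le k \le n$ let $$\operatorname{Gr}(k,\mathbb{R}^n) = \{X \in \mathrm{O}(n) : X^2 = I_n,\ \operatorname{tr} X = 2k-n\}$$ be the involution model of the Grassmannian of $k$-dimensional subspaces of $\mathbb{R}^n$, and let $$\Phi(k,k',\mathbb{R}^n) = \operatorname{Gr}(k,\mathbb{R}^n)\cdot\operatorname{Gr}(k',\mathbb{R}^n) = \{XY : X \in \operatorname{Gr}(k,\mathbb{R}^n),\ Y \in \operatorname{Gr}(k',\mathbb{R}^n)\}.$$ Let $\mathrm{SO}(n)$ and $\mathrm{SO}^-(n)$ be the sets of $X \in \mathrm{O}(n)$ with $\det X = 1$ and $\det X = -1$ respectively. The real dimension $\dim S$ of a semialgebraic set $S \subseteq \mathbb{R}^{n\times n}$ is the Krull dimension of its ring of polynomial functions $\mathbb{R}[x_{11},\dots,x_{nn}]/I(S)$, where $I(S)$ is the ideal of the polynomials vanishing on $S$. Let $k, k', n$ be integers with $0 \le k' \le k < n$ and $k + k' \le n$. Then $$\dim \Phi(k,k',\mathbb{R}^n) = k(n-k) + k'(n-k') - k'.$$ Moreover,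 * $\Phi(k,k',\mathbb{R}^n) = \mathrm{SO}(n)$ if and only if $k = k'$ and $n \in \{2k, 2k+1\}$; * $\Phi(k,k',\mathbb{R}^n) = \mathrm{SO}^-(n)$ if and only if $k = k'+1$ and $n \in \{2k-1, 2k\}$. In particular, for every integer $n \ge 1$, $$\mathrm{SO}(n) = \operatorname{Gr}(\lfloor n/2\rfloor,\mathbb{R}^n)\cdot \operatorname{Gr}(\lfloor n/2\rfloor,\mathbb{R}^n).$$ -/

import Mathlib

open scoped Pointwise

/-- The involution model of the real Grassmannian of `k`-planes in `ℝⁿ`: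
the orthogonal matrices `X` with `X² = I` and `tr X = 2k - n`. -/
def realGr (k n : ℕ) : Set (Matrix (Fin n) (Fin n) ℝ) :=
  {X | X ∈ Matrix.orthogonalGroup (Fin n) ℝ ∧ X ^ 2 = 1 ∧ X.trace = 2 * (k : ℝ) - (n : ℝ)}

/-- The set `Φ(k, k', ℝⁿ)` of all matrix products `X * Y` with `X` a point of the Grassmannian
of `k`-planes and `Y` a point of the Grassmannian of `k'`-planes. -/
def prodGr (k k' n : ℕ) : Set (Matrix (Fin n) (Fin n) ℝ) :=
  {Z | ∃ X ∈ realGr k n, ∃ Y ∈ realGr k' n, Z = X * Y}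

/-- The special orthogonal group as a set of matrices. -/
def setSO (n : ℕ) : Set (Matrix (Fin n) (Fin n) ℝ) :=
  {X | X ∈ Matrix.orthogonalGroup (Fin n) ℝ ∧ X.det = 1}

/-- The orthogonal matrices of determinant `-1`. -/
def setSOMinus (n : ℕ) : Set (Matrix (Fin n) (Fin n) ℝ) :=
  {X | X ∈ Matrix.orthogonalGroup (Fin n) ℝ ∧ X.det = -1}

/-- The ideal of all real polynomials in the `n²` matrix entries that vanish at every point
of `S`. -/
noncomputable def matrixVanishingIdeal {n : ℕ} (S : Set (Matrix (Fin n) (Fin n) ℝ)) :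
    Ideal (MvPolynomial (Fin n × Fin n) ℝ) :=
  MvPolynomial.vanishingIdeal ℝ ((fun (X : Matrix (Fin n) (Fin n) ℝ) p => X p.1 p.2) '' S)

/-- The real dimension of a real semialgebraic set `S` of `n × n` matrices, by the standard
definition of real algebraic geometry: the Krull dimension of the ring
`ℝ[x₁₁, …, xₙₙ] / I(S)` of polynomial functions on `S`. -/
noncomputable def realDim {n : ℕ} (S : Set (Matrix (Fin n) (Fin n) ℝ)) : WithBot ℕ∞ :=
  ringKrullDim (MvPolynomial (Fin n × Fin n) ℝ ⧸ matrixVanishingIdeal S)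

/-! Put `k' = c`, `k = c + b`, `n = 2c + b + a`. A product `Z = XY` of reflections of these types is
orthogonal of determinant `(-1)^b`. It fixes at least `a` independent directions, where `X` and `Y`
are both `-1`, and negates at least `b`, where `X` is `1` and `Y` is `-1`
(`IsGrassmannian.mul_eigenspaces`). These properties also suffice (`exists_mul_isGrassmannian`):
splitting off the two eigenframes leaves a rotation of a `2c`-dimensional space, which breaks into
plane rotations, each a product of two line reflections (`exists_mul_isGrassmannian_of_det_eq_one`).

For the dimension, `chart` has three matrix parameters: `C` of size `2c × (b+a)`, with the rows of
`(1 | C)` spanning the rotated space; a skew `A` of size `2c`, giving the rotation by a Cayley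
transform; and `D` of size `a × b`, giving the negated space inside the orthogonal complement. Its
values lie in the product set (`chart_mem`) and are dense there (`mem_closure_range_chart`), and the
parameters are generically rational functions of the value (`coord_isRatIn`). So the coordinate ring
embeds in the rational function field of the parameters, with that field as its field of fractions,
and its Krull dimension is the number of parameters, `c(2c-1) + 2c(a+b) + ab`
(`ringKrullDim_quotient_vanishingIdeal_eq_card`).

The defect from `n(n-1)/2` is `(a(a-1) + b(b-1))/2`, so equality with either component of the
orthogonal group forces `a, b ≤ 1`, and the determinant then decides `b`. Conversely, for `a, b ≤ 1`
the determinant alone forces the required eigenvalues. -/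

set_option linter.unusedSectionVars false

/-! ### Krull dimension and transcendence degree -/

section KrullDimension

/-- Incomparability makes contraction of primes strictly monotone. Conversely, injectivity lets
lying-over reach the bottom of any chain in `R`, and going-up lifts the rest. -/
theorem ringKrullDim_eq_of_isIntegral_of_faithfulSMul (R S : Type*) [CommRing R] [CommRing S]
    [Algebra R S] [Algebra.IsIntegral R S] [FaithfulSMul R S] :
    ringKrullDim S = ringKrullDim R := by
  refine le_antisymm ?_ ?_
  · refine Order.krullDim_le_of_strictMono (PrimeSpectrum.comap (algebraMap R S)) ?_
    intro p q hpq
    exact Ideal.IsIntegral.comap_lt_comap (R := R) (I := p.asIdeal) (J := q.asIdeal) hpq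
  · refine iSup_le fun l => ?_
    have hker : RingHom.ker (algebraMap R S) ≤ (RelSeries.head l).asIdeal := by
      rw [(RingHom.injective_iff_ker_eq_bot _).1 (FaithfulSMul.algebraMap_injective R S)]
      exact bot_le
    obtain ⟨Q, -, hQ, hQl⟩ := Ideal.exists_ideal_over_prime_of_isIntegral
      (RelSeries.head l).asIdeal (⊥ : Ideal S) hker
    have : Q.LiesOver (RelSeries.head l).asIdeal := ⟨hQl.symm⟩
    obtain ⟨L, hL, -⟩ := Ideal.exists_ltSeries_of_hasGoingUp l Q
    rw [← hL]
    exact Order.LTSeries.length_le_krullDim L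

/-- Noether normalisation makes `A` integral over a polynomial ring, and the transcendence degree
counts its variables. -/
theorem ringKrullDim_eq_of_trdeg_eq (k A : Type) [Field k] [CommRing A] [IsDomain A]
    [Algebra k A] [Algebra.FiniteType k A] {d : ℕ} (h : Algebra.trdeg k A = d) :
    ringKrullDim A = d := by
  obtain ⟨s, g, hinj, hint⟩ := exists_integral_inj_algHom_of_fg k A
  algebraize [g.toRingHom]
  have hI : Algebra.IsIntegral (MvPolynomial (Fin s) k) A := ⟨hint⟩
  have hF : FaithfulSMul (MvPolynomial (Fin s) k) A :=
    (faithfulSMul_iff_algebraMap_injective _ _).2 hinj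
  have hT : IsScalarTower k (MvPolynomial (Fin s) k) A :=
    IsScalarTower.of_algebraMap_eq fun x => (g.commutes x).symm
  have h1 := trdeg_add_eq k (MvPolynomial (Fin s) k) (A := A)
  have h2 : Algebra.trdeg (MvPolynomial (Fin s) k) A = 0 := trdeg_eq_zero
  rw [h2, add_zero, MvPolynomial.trdeg_of_isDomain, h] at h1
  have hs : s = d := by simpa using h1
  rw [ringKrullDim_eq_of_isIntegral_of_faithfulSMul (MvPolynomial (Fin s) k) A,
    MvPolynomial.ringKrullDim_of_isNoetherianRing, ringKrullDim_eq_zero_of_field]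
  simp [hs]

/-- An algebra homomorphism from a polynomial ring whose image generates, up to fractions, a
rational function field in `d` variables has a coordinate ring of dimension `d`. -/
theorem ringKrullDim_quotient_ker_eq_card {k ι τ : Type} [Field k] [Fintype ι] [Fintype τ]
    (ψ : MvPolynomial ι k →ₐ[k] FractionRing (MvPolynomial τ k))
    (hψ : ∀ j, ∃ a b, ψ b ≠ 0 ∧
      algebraMap (MvPolynomial τ k) (FractionRing (MvPolynomial τ k)) (MvPolynomial.X j) * ψ b
        = ψ a) :
    ringKrullDim (MvPolynomial ι k ⧸ RingHom.ker ψ) = Fintype.card τ := by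
  set K := FractionRing (MvPolynomial τ k)
  have e := Ideal.quotientKerEquivRange ψ
  have hft : Algebra.FiniteType k ψ.range :=
    Algebra.FiniteType.of_surjective ψ.rangeRestrict ψ.rangeRestrict_surjective
  rw [ringKrullDim_eq_of_ringEquiv e.toRingEquiv]
  refine ringKrullDim_eq_of_trdeg_eq k ψ.range ?_
  have : Algebra.IsAlgebraic (MvPolynomial τ k) K :=
    IsLocalization.isAlgebraic _ (nonZeroDivisors (MvPolynomial τ k))
  have hKt : Algebra.trdeg k K = Fintype.card τ := by
    rw [← trdeg_add_eq k (MvPolynomial τ k) (A := K), MvPolynomial.trdeg_of_isDomain,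
      trdeg_eq_zero]
    simp
  -- Every variable is a quotient of two elements of the range, so the range and `K` have the same
  -- transcendence degree.
  have halg : Algebra.IsAlgebraic ψ.range K := by
    have hX : ∀ j, IsAlgebraic ψ.range (algebraMap (MvPolynomial τ k) K (MvPolynomial.X j)) := by
      intro j
      obtain ⟨a, b, hb, hab⟩ := hψ j
      have h1 : IsAlgebraic ψ.range (ψ a) :=
        isAlgebraic_algebraMap (R := ψ.range) (A := K) ⟨ψ a, a, rfl⟩
      have h2 : IsAlgebraic ψ.range (ψ b) :=
        isAlgebraic_algebraMap (R := ψ.range) (A := K) ⟨ψ b, b, rfl⟩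
      rw [eq_div_of_mul_eq hb hab]
      rw [div_eq_mul_inv]
      exact h1.mul h2.inv
    have hP : ∀ p, IsAlgebraic ψ.range (algebraMap (MvPolynomial τ k) K p) := by
      intro p
      induction p using MvPolynomial.induction_on with
      | C c =>
        have : algebraMap (MvPolynomial τ k) K (MvPolynomial.C c)
            = algebraMap ψ.range K (algebraMap k ψ.range c) := by
          rw [← MvPolynomial.algebraMap_eq, ← IsScalarTower.algebraMap_apply,
            ← IsScalarTower.algebraMap_apply]
        rw [this]
        exact isAlgebraic_algebraMap _
      | add p q hp hq => rw [map_add]; exact hp.add hq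
      | mul_X p j hp => rw [map_mul]; exact hp.mul (hX j)
    refine ⟨fun x => ?_⟩
    obtain ⟨p, q, -, rfl⟩ := IsFractionRing.div_surjective (A := MvPolynomial τ k) x
    rw [div_eq_mul_inv]
    exact (hP p).mul (hP q).inv
  have : FaithfulSMul k ψ.range :=
    (faithfulSMul_iff_algebraMap_injective _ _).2 (algebraMap k ψ.range).injective
  rw [← hKt, ← trdeg_add_eq k ψ.range (A := K), trdeg_eq_zero (R := ψ.range),
    add_zero]

end KrullDimension

/-! ### Generic properties and rational functions -/

section Rational

open MvPolynomial

/-- The filter of sets containing the complement of a proper algebraic hypersurface. -/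
def genericFilter (τ : Type) : Filter (τ → ℝ) where
  sets := {s | ∃ q : MvPolynomial τ ℝ, q ≠ 0 ∧ ∀ t, eval t q ≠ 0 → t ∈ s}
  univ_sets := ⟨1, one_ne_zero, fun _ _ => trivial⟩
  sets_of_superset := fun ⟨q, hq, h⟩ hst => ⟨q, hq, fun t ht => hst (h t ht)⟩
  inter_sets := fun ⟨q, hq, h⟩ ⟨q', hq', h'⟩ => ⟨q * q', mul_ne_zero hq hq', fun t ht => by
    rw [map_mul] at ht
    exact ⟨h t (left_ne_zero_of_mul ht), h' t (right_ne_zero_of_mul ht)⟩⟩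

variable {τ ι : Type}

theorem eventually_eval_ne_zero {q : MvPolynomial τ ℝ} (hq : q ≠ 0) :
    ∀ᶠ t in genericFilter τ, eval t q ≠ 0 := ⟨q, hq, fun _ h => h⟩

/-- A nonzero polynomial cannot vanish on an open box, which is a product of infinite sets. -/
theorem dense_of_eventually_genericFilter [Finite τ] {P : (τ → ℝ) → Prop}
    (h : ∀ᶠ t in genericFilter τ, P t) : Dense {t | P t} := by
  have := Fintype.ofFinite τ
  obtain ⟨q, hq, h⟩ := h
  intro x
  rw [Metric.mem_closure_iff]
  intro ε hε
  by_contra! hcon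
  refine hq (MvPolynomial.funext_set (fun i => Metric.ball (x i) ε) (fun i => ?_) fun t ht => ?_)
  · rw [Real.ball_eq_Ioo]
    exact Set.Ioo_infinite (by linarith)
  · by_contra hne
    have h1 := hcon t (h t (by simpa using hne))
    have h2 : dist x t < ε := by
      rw [dist_pi_lt_iff hε]
      intro i
      have := ht i trivial
      rwa [dist_comm]
    linarith

theorem eq_zero_of_eventually_eval_eq_zero [Finite τ] {q : MvPolynomial τ ℝ}
    (h : ∀ᶠ t in genericFilter τ, eval t q = 0) : q = 0 := by
  by_contra hq
  obtain ⟨t, h1, h2⟩ :=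
    (dense_of_eventually_genericFilter (h.and (eventually_eval_ne_zero hq))).nonempty
  exact h2 h1

/-- `f` is generically a rational function of `φ`. -/
def IsRatIn (φ : (τ → ℝ) → ι → ℝ) (f : (τ → ℝ) → ℝ) : Prop :=
  ∃ a b : MvPolynomial ι ℝ, (∀ᶠ t in genericFilter τ, eval (φ t) b ≠ 0) ∧
    ∀ᶠ t in genericFilter τ, f t * eval (φ t) b = eval (φ t) a

/-- `f` is generically a rational function. -/
abbrev IsRat (f : (τ → ℝ) → ℝ) : Prop := IsRatIn id f

/-- The function vanishes generically, or it is generically nonzero. -/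
def GenericDichotomy (f : (τ → ℝ) → ℝ) : Prop :=
  (∀ᶠ t in genericFilter τ, f t = 0) ∨ ∀ᶠ t in genericFilter τ, f t ≠ 0

/-- The numerator is either the zero polynomial or generically nonzero. Hence a single well-chosen
parameter can establish generic invertibility. -/
theorem IsRat.dichotomy {f : (τ → ℝ) → ℝ} (hf : IsRat f) : GenericDichotomy f := by
  obtain ⟨a, b, hb, hab⟩ := hf
  by_cases ha : a = 0
  · left
    filter_upwards [hb, hab] with t h1 h2
    subst ha
    simp only [map_zero] at h2
    exact (mul_eq_zero.1 h2).resolve_right h1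
  · right
    filter_upwards [eventually_eval_ne_zero ha, hab] with t h1 h2 h3
    rw [h3, zero_mul] at h2
    exact h1 h2.symm

namespace IsRatIn

variable {φ : (τ → ℝ) → ι → ℝ} {f g : (τ → ℝ) → ℝ}

theorem const (c : ℝ) : IsRatIn φ (fun _ => c) :=
  ⟨C c, 1, by simp, by simp⟩

theorem coord (i : ι) : IsRatIn φ (fun t => φ t i) :=
  ⟨X i, 1, by simp, by simp⟩

theorem congr (hf : IsRatIn φ f) (h : ∀ᶠ t in genericFilter τ, g t = f t) : IsRatIn φ g := by
  obtain ⟨a, b, hb, hab⟩ := hf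
  refine ⟨a, b, hb, ?_⟩
  filter_upwards [h, hab] with t h1 h2
  rw [h1, h2]

theorem add (hf : IsRatIn φ f) (hg : IsRatIn φ g) : IsRatIn φ (fun t => f t + g t) := by
  obtain ⟨a, b, hb, hab⟩ := hf
  obtain ⟨a', b', hb', hab'⟩ := hg
  refine ⟨a * b' + a' * b, b * b', ?_, ?_⟩
  · filter_upwards [hb, hb'] with t h h'
    simp [h, h']
  · filter_upwards [hab, hab'] with t h h'
    simp only [map_add, map_mul, ← h, ← h']
    ring

theorem mul (hf : IsRatIn φ f) (hg : IsRatIn φ g) : IsRatIn φ (fun t => f t * g t) := by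
  obtain ⟨a, b, hb, hab⟩ := hf
  obtain ⟨a', b', hb', hab'⟩ := hg
  refine ⟨a * a', b * b', ?_, ?_⟩
  · filter_upwards [hb, hb'] with t h h'
    simp [h, h']
  · filter_upwards [hab, hab'] with t h h'
    simp only [map_mul, ← h, ← h']
    ring

theorem neg (hf : IsRatIn φ f) : IsRatIn φ (fun t => -f t) := by
  simpa using (const (φ := φ) (-1)).mul hf

theorem sub (hf : IsRatIn φ f) (hg : IsRatIn φ g) : IsRatIn φ (fun t => f t - g t) := by
  simpa [sub_eq_add_neg] using hf.add hg.neg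

theorem sum {κ : Type*} (s : Finset κ) {F : κ → (τ → ℝ) → ℝ} (h : ∀ i ∈ s, IsRatIn φ (F i)) :
    IsRatIn φ (fun t => ∑ i ∈ s, F i t) := by
  classical
  induction s using Finset.induction_on with
  | empty => simpa using const 0
  | insert i s hi ih =>
    simp only [Finset.sum_insert hi]
    exact (h i (by simp)).add (ih fun j hj => h j (by simp [hj]))

theorem prod {κ : Type*} (s : Finset κ) {F : κ → (τ → ℝ) → ℝ} (h : ∀ i ∈ s, IsRatIn φ (F i)) :
    IsRatIn φ (fun t => ∏ i ∈ s, F i t) := by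
  classical
  induction s using Finset.induction_on with
  | empty => simpa using const 1
  | insert i s hi ih =>
    simp only [Finset.prod_insert hi]
    exact (h i (by simp)).mul (ih fun j hj => h j (by simp [hj]))

theorem eval_comp (hφ : ∀ i, IsRat (fun t => φ t i)) (p : MvPolynomial ι ℝ) :
    IsRat (fun t => eval (φ t) p) := by
  induction p using MvPolynomial.induction_on with
  | C c => simpa using const c
  | add p q hp hq => simpa using hp.add hq
  | mul_X p i hp => simpa using hp.mul (hφ i)

theorem inv (hφ : ∀ i, IsRat (fun t => φ t i)) (hf : IsRatIn φ f) :
    IsRatIn φ (fun t => (f t)⁻¹) := by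
  obtain ⟨a, b, hb, hab⟩ := hf
  -- If the numerator vanishes generically along `φ`, then so does `f`, and the convention `0⁻¹ = 0`
  -- makes the inverse generically the constant `0`.
  rcases (eval_comp hφ a).dichotomy with h0 | h1
  · refine (const (φ := φ) 0).congr ?_
    filter_upwards [h0, hb, hab] with t h h' h''
    rw [h] at h''
    simpa using (mul_eq_zero.1 h'').resolve_right h'
  · refine ⟨b, a, h1, ?_⟩
    filter_upwards [h1, hb, hab] with t h h' h''
    have hf0 : f t ≠ 0 := by
      intro h3
      rw [h3, zero_mul] at h''
      exact h h''.symm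
    rw [← h'', inv_mul_cancel_left₀ hf0]

end IsRatIn

theorem isRat_coord (i : τ) : IsRat (fun t : τ → ℝ => t i) := IsRatIn.coord (φ := id) i

/-- A matrix whose entries are generically rational functions of `φ`. -/
def MatIsRatIn {m n : Type*} (φ : (τ → ℝ) → ι → ℝ) (A : (τ → ℝ) → Matrix m n ℝ) : Prop :=
  ∀ i j, IsRatIn φ (fun t => A t i j)

namespace MatIsRatIn

variable {φ : (τ → ℝ) → ι → ℝ} {m n l o : Type*} {A B : (τ → ℝ) → Matrix m n ℝ}

theorem const (A : Matrix m n ℝ) : MatIsRatIn φ (fun _ => A) := fun _ _ => IsRatIn.const _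

theorem congr (hA : MatIsRatIn φ A) (h : ∀ᶠ t in genericFilter τ, B t = A t) :
    MatIsRatIn φ B := fun i j =>
  (hA i j).congr (h.mono fun t ht => by rw [ht])

theorem add (hA : MatIsRatIn φ A) (hB : MatIsRatIn φ B) : MatIsRatIn φ (fun t => A t + B t) :=
  fun i j => (hA i j).add (hB i j)

theorem sub (hA : MatIsRatIn φ A) (hB : MatIsRatIn φ B) : MatIsRatIn φ (fun t => A t - B t) :=
  fun i j => (hA i j).sub (hB i j)

theorem neg (hA : MatIsRatIn φ A) : MatIsRatIn φ (fun t => - A t) :=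
  fun i j => (hA i j).neg

theorem smul (c : ℝ) (hA : MatIsRatIn φ A) : MatIsRatIn φ (fun t => c • A t) :=
  fun i j => (IsRatIn.const c).mul (hA i j)

theorem transpose (hA : MatIsRatIn φ A) : MatIsRatIn φ (fun t => (A t).transpose) :=
  fun i j => hA j i

theorem submatrix (hA : MatIsRatIn φ A) (r : l → m) (c : o → n) :
    MatIsRatIn φ (fun t => (A t).submatrix r c) := fun i j => hA (r i) (c j)

theorem mul [Fintype n] {B : (τ → ℝ) → Matrix n l ℝ} (hA : MatIsRatIn φ A)
    (hB : MatIsRatIn φ B) : MatIsRatIn φ (fun t => A t * B t) := by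
  intro i j
  simp only [Matrix.mul_apply]
  exact IsRatIn.sum _ fun x _ => (hA i x).mul (hB x j)

theorem det [Fintype n] [DecidableEq n] {A : (τ → ℝ) → Matrix n n ℝ} (hA : MatIsRatIn φ A) :
    IsRatIn φ (fun t => (A t).det) := by
  simp only [Matrix.det_apply']
  exact IsRatIn.sum _ fun σ _ => (IsRatIn.const _).mul (IsRatIn.prod _ fun i _ => hA _ _)

/-- Cramer's rule. Invertibility is not needed, since the junk value for a singular matrix follows
the same formula. -/
theorem inv [Fintype n] [DecidableEq n] (hφ : ∀ i, IsRat (fun t => φ t i))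
    {A : (τ → ℝ) → Matrix n n ℝ} (hA : MatIsRatIn φ A) :
    MatIsRatIn φ (fun t => (A t)⁻¹) := by
  intro i j
  simp only [Matrix.inv_def, Ring.inverse_eq_inv', Matrix.smul_apply, smul_eq_mul,
    Matrix.adjugate_apply]
  refine (hA.det.inv hφ).mul (det (A := fun t => (A t).updateRow j (Pi.single i 1)) ?_)
  intro x y
  by_cases h : x = j
  · subst h
    simpa using IsRatIn.const _
  · simpa [Matrix.updateRow_ne h] using hA x y

end MatIsRatIn

/-- The map `ψ` substitutes formal fractions for the coordinates of `φ`. One pair `p, q` represents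
both `ψ F` and the generic values of `F` along `φ`, so identities pass between the function field
and generic points. -/
theorem exists_fraction_of_isRat {φ : (τ → ℝ) → ι → ℝ} (hφ : ∀ i, IsRat (fun t => φ t i)) :
    ∃ ψ : MvPolynomial ι ℝ →ₐ[ℝ] FractionRing (MvPolynomial τ ℝ), ∀ F, ∃ p q : MvPolynomial τ ℝ,
      q ≠ 0 ∧ ψ F * algebraMap _ _ q = algebraMap _ _ p ∧
      ∀ᶠ t in genericFilter τ, eval (φ t) F * eval t q = eval t p := by
  have hφ' : ∀ i, ∃ p q : MvPolynomial τ ℝ, q ≠ 0 ∧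
      ∀ᶠ t in genericFilter τ, φ t i * eval t q = eval t p := by
    intro i
    obtain ⟨p, q, hq, hpq⟩ := hφ i
    refine ⟨p, q, ?_, hpq⟩
    rintro rfl
    obtain ⟨r, hr, hq⟩ := hq
    exact hr (MvPolynomial.funext fun t => by
      by_contra h
      exact hq t (by simpa using h) (by simp))
  choose p q hq hpq using hφ'
  have hne : ∀ r : MvPolynomial τ ℝ, r ≠ 0 →
      algebraMap (MvPolynomial τ ℝ) (FractionRing (MvPolynomial τ ℝ)) r ≠ 0 := fun r hr => by
    simpa using hr
  refine ⟨aeval fun i => algebraMap _ _ (p i) / algebraMap _ _ (q i), fun F => ?_⟩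
  induction F using MvPolynomial.induction_on with
  | C c =>
    refine ⟨C c, 1, one_ne_zero, ?_, by simp⟩
    simp only [map_one, mul_one, ← MvPolynomial.algebraMap_eq]
    rw [← IsScalarTower.algebraMap_apply, AlgHom.commutes]
  | add F G hF hG =>
    obtain ⟨a, b, hb, h1, h2⟩ := hF
    obtain ⟨a', b', hb', h1', h2'⟩ := hG
    refine ⟨a * b' + a' * b, b * b', mul_ne_zero hb hb', ?_, ?_⟩
    · simp only [map_add, map_mul, ← h1, ← h1']
      ring
    · filter_upwards [h2, h2'] with t h h'
      simp only [map_add, map_mul, ← h, ← h']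
      ring
  | mul_X F i hF =>
    obtain ⟨a, b, hb, h1, h2⟩ := hF
    refine ⟨a * p i, b * q i, mul_ne_zero hb (hq i), ?_, ?_⟩
    · simp only [map_mul, aeval_X, ← h1]
      have := hne _ (hq i)
      field_simp
    · filter_upwards [h2, hpq i] with t h h'
      simp only [map_mul, eval_X, ← h, ← h']
      ring

/-- The dimension of the closure of a rationally parametrized set whose parameters are generically
rational functions of the point. -/
theorem ringKrullDim_quotient_vanishingIdeal_eq_card [Fintype τ] [Fintype ι]
    {φ : (τ → ℝ) → ι → ℝ} (hc : Continuous φ) (hφ : ∀ i, IsRat (fun t => φ t i))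
    (hinv : ∀ j, IsRatIn φ (fun t => t j)) {S : Set (ι → ℝ)} (hS : Set.range φ ⊆ S)
    (hS' : S ⊆ closure (Set.range φ)) :
    ringKrullDim (MvPolynomial ι ℝ ⧸ vanishingIdeal ℝ S) = Fintype.card τ := by
  obtain ⟨ψ, hψ⟩ := exists_fraction_of_isRat hφ
  have hinj := IsFractionRing.injective (MvPolynomial τ ℝ) (FractionRing (MvPolynomial τ ℝ))
  have hne : ∀ r : MvPolynomial τ ℝ, r ≠ 0 →
      algebraMap (MvPolynomial τ ℝ) (FractionRing (MvPolynomial τ ℝ)) r ≠ 0 := fun r hr => by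
    simpa using hr
  have hzero : ∀ F, ψ F = 0 ↔ ∀ᶠ t in genericFilter τ, eval (φ t) F = 0 := by
    intro F
    obtain ⟨p, q, hq, h1, h2⟩ := hψ F
    constructor
    · intro h
      rw [h, zero_mul] at h1
      have hp : p = 0 := hinj (by rw [← h1, map_zero])
      subst hp
      filter_upwards [h2, eventually_eval_ne_zero hq] with t h h'
      simpa [h'] using h
    · intro h
      have hp : p = 0 := eq_zero_of_eventually_eval_eq_zero (by
        filter_upwards [h, h2] with t h h'
        rw [← h', h, zero_mul])
      rw [hp, map_zero] at h1
      exact (mul_eq_zero.1 h1).resolve_right (hne q hq)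
  -- Generic vanishing along `φ` spreads by density and continuity to all parameters, and then to
  -- the closure of the range, which contains `S`.
  have hker : vanishingIdeal ℝ S = RingHom.ker ψ := by
    ext F
    rw [mem_vanishingIdeal_iff, RingHom.mem_ker, hzero]
    constructor
    · intro h
      filter_upwards with t
      exact h _ (hS ⟨t, rfl⟩)
    · intro h x hx
      have hclosed : IsClosed {y : ι → ℝ | eval y F = 0} :=
        isClosed_eq (MvPolynomial.continuous_eval F) continuous_const
      have hall : ∀ t, eval (φ t) F = 0 := by
        intro t
        have hcl : IsClosed {t | eval (φ t) F = 0} := hclosed.preimage hc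
        have := dense_of_eventually_genericFilter h t
        rwa [hcl.closure_eq] at this
      have hx' := closure_minimal (by rintro _ ⟨t, rfl⟩; exact hall t) hclosed (hS' hx)
      exact hx'
  rw [hker]
  refine ringKrullDim_quotient_ker_eq_card ψ fun j => ?_
  obtain ⟨a, b, hb, hab⟩ := hinv j
  refine ⟨a, b, ?_, ?_⟩
  · intro h
    rw [hzero] at h
    obtain ⟨t, h1, h2⟩ := (dense_of_eventually_genericFilter (h.and hb)).nonempty
    exact h2 h1
  · obtain ⟨p, q, hq, h1, h2⟩ := hψ a
    obtain ⟨p', q', hq', h1', h2'⟩ := hψ b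
    have : X j * p' * q = p * q' := by
      rw [← sub_eq_zero]
      refine eq_zero_of_eventually_eval_eq_zero ?_
      filter_upwards [hab, h2, h2'] with t h h' h''
      simp only [map_sub, map_mul, eval_X, ← h', ← h'', ← h]
      ring
    have h3 := congrArg (algebraMap (MvPolynomial τ ℝ) (FractionRing (MvPolynomial τ ℝ))) this
    simp only [map_mul, ← h1, ← h1'] at h3
    refine mul_right_cancel₀ (mul_ne_zero (hne q hq) (hne q' hq')) ?_
    linear_combination h3

end Rational

/-! ### Reflections, and rotations as products of two of them -/

section Involutions

open Matrix

variable {ι κ μ σ : Type} [Fintype ι] [DecidableEq ι] [Fintype κ] [DecidableEq κ]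
  [Fintype μ] [DecidableEq μ] [Fintype σ] [DecidableEq σ]

/-- The involution model of the Grassmannian, over an arbitrary finite index type. -/
structure IsGrassmannian (k : ℕ) (X : Matrix ι ι ℝ) : Prop where
  symm : Xᵀ = X
  sq : X * X = 1
  trace : X.trace = 2 * (k : ℝ) - Fintype.card ι

theorem mem_realGr_iff {k n : ℕ} {X : Matrix (Fin n) (Fin n) ℝ} :
    X ∈ realGr k n ↔ IsGrassmannian k X := by
  constructor
  · rintro ⟨h1, h2, h3⟩
    rw [mem_orthogonalGroup_iff] at h1
    rw [pow_two] at h2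
    refine ⟨?_, h2, by simpa using h3⟩
    calc Xᵀ = X * X * Xᵀ := by rw [h2, one_mul]
      _ = X := by rw [mul_assoc, h1, mul_one]
  · rintro ⟨h1, h2, h3⟩
    refine ⟨?_, by rw [pow_two, h2], by simpa using h3⟩
    rw [mem_orthogonalGroup_iff, h1, h2]

theorem IsGrassmannian.of_frame {Q : Matrix ι σ ℝ} (hQ : Qᵀ * Q = 1) :
    IsGrassmannian (Fintype.card σ) ((2 : ℝ) • (Q * Qᵀ) - 1) := by
  refine ⟨by simp, ?_, ?_⟩
  · have : Q * Qᵀ * (Q * Qᵀ) = Q * Qᵀ := by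
      rw [Matrix.mul_assoc, ← Matrix.mul_assoc Qᵀ, hQ, Matrix.one_mul]
    simp only [sub_mul, mul_sub, Matrix.smul_mul, Matrix.mul_smul, this, mul_one, one_mul]
    module
  · rw [trace_sub, trace_smul, trace_mul_comm, hQ]
    simp

/-- By the spectral theorem `X` has an orthonormal eigenbasis with eigenvalues `±1`, and the trace
says that exactly `k` of them are `1`. Those eigenvectors are the columns of `Q`. -/
theorem IsGrassmannian.exists_frame {k : ℕ} {X : Matrix ι ι ℝ} (hX : IsGrassmannian k X)
    (hk : Fintype.card σ = k) :
    ∃ Q : Matrix ι σ ℝ, Qᵀ * Q = 1 ∧ X = (2 : ℝ) • (Q * Qᵀ) - 1 := by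
  have hH : X.IsHermitian := by
    rw [Matrix.IsHermitian, conjTranspose_eq_transpose_of_trivial, hX.symm]
  set V : Matrix ι ι ℝ := hH.eigenvectorUnitary.1 with hV
  set D : ι → ℝ := hH.eigenvalues with hD
  have hVV : Vᵀ * V = 1 := by
    have := (mem_unitaryGroup_iff').1 hH.eigenvectorUnitary.2
    rwa [star_eq_conjTranspose, conjTranspose_eq_transpose_of_trivial] at this
  have hVV' : V * Vᵀ = 1 := mul_eq_one_comm.1 hVV
  have hsp : X = V * diagonal D * Vᵀ := by
    have := hH.spectral_theorem
    rw [Unitary.conjStarAlgAut_apply, star_eq_conjTranspose,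
      conjTranspose_eq_transpose_of_trivial] at this
    exact this
  have hDD : ∀ i, D i * D i = 1 := by
    have h1 : diagonal D * diagonal D = 1 := by
      have h2 : Vᵀ * (X * X) * V = 1 := by rw [hX.sq, mul_one, hVV]
      rw [hsp] at h2
      calc diagonal D * diagonal D = (Vᵀ * V) * diagonal D * (Vᵀ * V) * diagonal D * (Vᵀ * V) := by
            simp [hVV]
        _ = 1 := by rw [← h2]; simp only [mul_assoc]
    intro i
    have := congrFun (congrFun h1 i) i
    simpa [diagonal_mul_diagonal] using this
  have hD1 : ∀ i, D i = if D i = 1 then 1 else -1 := by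
    intro i
    rcases mul_self_eq_one_iff.1 (hDD i) with h | h
    · simp [h]
    · simp only [h]; norm_num
  have htr : X.trace = ∑ i, D i := by
    rw [hsp, trace_mul_comm, ← mul_assoc, hVV, one_mul, trace_diagonal]
  have hcard : Fintype.card {i // D i = 1} = k := by
    have h1 := hX.trace
    have h3 : ∀ i, D i = 2 * (if D i = 1 then (1 : ℝ) else 0) - 1 := by
      intro i
      conv_lhs => rw [hD1 i]
      split_ifs <;> norm_num
    have h2 : ∑ i, D i = 2 * (Fintype.card {i // D i = 1} : ℝ) - Fintype.card ι := by
      rw [Finset.sum_congr rfl fun i _ => h3 i, Finset.sum_sub_distrib, ← Finset.mul_sum,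
        Finset.sum_boole, Fintype.card_subtype]
      simp
    rw [htr, h2] at h1
    have : (Fintype.card {i // D i = 1} : ℝ) = k := by linarith
    exact_mod_cast this
  let e : σ ≃ {i // D i = 1} := Fintype.equivOfCardEq (hk.trans hcard.symm)
  refine ⟨V.submatrix id fun s => (e s).1, ?_, ?_⟩
  · ext a b
    have := congrFun (congrFun hVV (e a).1) (e b).1
    simp only [mul_apply, transpose_apply, one_apply, submatrix_apply, id] at this ⊢
    rw [this]
    simp [Subtype.ext_iff.symm]
  · rw [hsp]
    ext i j
    have h4 : ((V * Vᵀ) : Matrix ι ι ℝ) i j = (1 : Matrix ι ι ℝ) i j := by rw [hVV']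
    simp only [Matrix.sub_apply, Matrix.smul_apply, ← h4, mul_apply, transpose_apply,
      submatrix_apply, id, smul_eq_mul]
    rw [e.sum_comp (fun s : {i // D i = 1} => V i s.1 * V j s.1),
      ← Finset.sum_subtype (Finset.univ.filter fun s => D s = 1) (by simp)
        (fun s => V i s * V j s), Finset.sum_filter, Finset.mul_sum, ← Finset.sum_sub_distrib]
    refine Finset.sum_congr rfl fun s _ => ?_
    have h5 : ∑ x, V i x * diagonal D x s = V i s * D s := by simp [diagonal_apply]
    rw [h5, hD1 s]
    by_cases h : D s = 1
    · simp only [h, if_true]; ring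
    · simp only [h, if_false]; norm_num

theorem IsGrassmannian.neg {k k' : ℕ} {X : Matrix ι ι ℝ} (hX : IsGrassmannian k X)
    (h : k + k' = Fintype.card ι) : IsGrassmannian k' (-X) := by
  refine ⟨by rw [transpose_neg, hX.symm], by rw [neg_mul_neg, hX.sq], ?_⟩
  rw [trace_neg, hX.trace, ← h]
  push_cast
  ring

theorem IsGrassmannian.det {k : ℕ} {X : Matrix ι ι ℝ} (hX : IsGrassmannian k X) :
    X.det = (-1) ^ (Fintype.card ι + k) := by
  obtain ⟨Q, hQ, rfl⟩ := hX.exists_frame (σ := Fin k) (by simp)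
  have : (2 : ℝ) • (Q * Qᵀ) - 1 = -(1 - ((2 : ℝ) • Q) * Qᵀ) := by
    rw [Matrix.smul_mul]; abel
  rw [this, det_neg, det_one_sub_mul_comm, Matrix.mul_smul, hQ]
  have : (1 : Matrix (Fin k) (Fin k) ℝ) - (2 : ℝ) • 1 = -1 := by module
  rw [this, det_neg, det_one, mul_one, pow_add]
  simp

theorem IsGrassmannian.conj {k : ℕ} {X : Matrix κ κ ℝ} (hX : IsGrassmannian k X)
    {g : Matrix ι κ ℝ} (h1 : gᵀ * g = 1) (h2 : g * gᵀ = 1) (hc : Fintype.card ι = Fintype.card κ) :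
    IsGrassmannian k (g * X * gᵀ) := by
  refine ⟨?_, ?_, ?_⟩
  · rw [transpose_mul, transpose_mul, hX.symm, transpose_transpose, Matrix.mul_assoc]
  · calc g * X * gᵀ * (g * X * gᵀ) = g * X * (gᵀ * g) * X * gᵀ := by
          simp only [Matrix.mul_assoc]
      _ = g * (X * X) * gᵀ := by rw [h1, Matrix.mul_one, Matrix.mul_assoc g X X]
      _ = 1 := by rw [hX.sq, Matrix.mul_one, h2]
  · rw [trace_mul_comm, ← Matrix.mul_assoc, h1, Matrix.one_mul, hX.trace, hc]

theorem IsGrassmannian.fromBlocks {k k' : ℕ} {X : Matrix ι ι ℝ} {Y : Matrix κ κ ℝ}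
    (hX : IsGrassmannian k X) (hY : IsGrassmannian k' Y) :
    IsGrassmannian (k + k') (Matrix.fromBlocks X 0 0 Y) := by
  refine ⟨?_, ?_, ?_⟩
  · simp [fromBlocks_transpose, hX.symm, hY.symm]
  · simp [fromBlocks_multiply, hX.sq, hY.sq]
  · rw [show (Matrix.fromBlocks X 0 0 Y).trace = X.trace + Y.trace by
      simp [Matrix.trace, Fintype.sum_sum_type], hX.trace, hY.trace]
    simp only [Fintype.card_sum]
    push_cast
    ring

theorem isGrassmannian_one : IsGrassmannian (Fintype.card ι) (1 : Matrix ι ι ℝ) :=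
  ⟨by simp, by simp, by simp; ring⟩

theorem isGrassmannian_neg_one : IsGrassmannian 0 (-1 : Matrix ι ι ℝ) :=
  ⟨by simp, by simp, by simp⟩

/-- Orthonormal columns can be completed to an orthogonal matrix. -/
theorem exists_orthonormal_completion {P : Matrix ι κ ℝ} (hP : Pᵀ * P = 1)
    (hc : Fintype.card κ + Fintype.card μ = Fintype.card ι) :
    ∃ G : Matrix ι μ ℝ, Gᵀ * G = 1 ∧ Pᵀ * G = 0 ∧ P * Pᵀ + G * Gᵀ = 1 := by
  -- The negative of the reflection fixing the span of `P` fixes exactly the orthogonal complement,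
  -- so any frame for it completes `P`.
  obtain ⟨G, hG, h⟩ := ((IsGrassmannian.of_frame hP).neg hc).exists_frame (σ := μ) rfl
  have hs : P * Pᵀ + G * Gᵀ = 1 := by
    have h2 : (2 : ℝ) • (P * Pᵀ + G * Gᵀ) = (2 : ℝ) • 1 := by
      rw [smul_add, ← sub_eq_zero]
      rw [← sub_eq_zero] at h
      rw [← neg_eq_zero, ← h, two_smul ℝ (1 : Matrix ι ι ℝ)]
      abel
    exact smul_right_injective _ (two_ne_zero) h2
  refine ⟨G, hG, ?_, hs⟩
  have h3 : Pᵀ * (P * Pᵀ + G * Gᵀ) * G = Pᵀ * G := by rw [hs, Matrix.mul_one]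
  rw [Matrix.mul_add, Matrix.add_mul, ← Matrix.mul_assoc, hP, Matrix.one_mul, Matrix.mul_assoc,
    Matrix.mul_assoc, hG, Matrix.mul_one] at h3
  simpa using h3

theorem fromCols_mul_transpose_self {P : Matrix ι κ ℝ} {G : Matrix ι μ ℝ}
    (hs : P * Pᵀ + G * Gᵀ = 1) : fromCols P G * (fromCols P G)ᵀ = 1 := by
  rw [transpose_fromCols, fromCols_mul_fromRows, hs]

theorem transpose_mul_self_fromCols {P : Matrix ι κ ℝ} {G : Matrix ι μ ℝ}
    (hP : Pᵀ * P = 1) (hG : Gᵀ * G = 1) (hPG : Pᵀ * G = 0) :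
    (fromCols P G)ᵀ * fromCols P G = 1 := by
  have hGP : Gᵀ * P = 0 := by simpa using congrArg Matrix.transpose hPG
  rw [transpose_fromCols, fromRows_mul_fromCols, hP, hG, hPG, hGP, fromBlocks_one]

theorem fromCols_mul_fromBlocks_mul_transpose {P : Matrix ι κ ℝ} {G : Matrix ι μ ℝ}
    (A : Matrix κ κ ℝ) (B : Matrix μ μ ℝ) :
    fromCols P G * Matrix.fromBlocks A 0 0 B * (fromCols P G)ᵀ = P * A * Pᵀ + G * B * Gᵀ := by
  rw [fromCols_mul_fromBlocks, transpose_fromCols, fromCols_mul_fromRows]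
  simp

/-- An orthogonal matrix preserving the span of the columns of `P` is block diagonal in an
orthonormal basis adapted to `P`. -/
theorem orthogonal_block_decomposition {Z : Matrix ι ι ℝ} (hZ : Zᵀ * Z = 1)
    {P : Matrix ι κ ℝ} {G : Matrix ι μ ℝ} {r : Matrix κ κ ℝ} (hP : Pᵀ * P = 1) (hG : Gᵀ * G = 1)
    (hPG : Pᵀ * G = 0) (hs : P * Pᵀ + G * Gᵀ = 1) (hr : Z * P = P * r) :
    rᵀ * r = 1 ∧ (Gᵀ * Z * G)ᵀ * (Gᵀ * Z * G) = 1 ∧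
      Z = P * r * Pᵀ + G * (Gᵀ * Z * G) * Gᵀ ∧ Z.det = r.det * (Gᵀ * Z * G).det := by
  have hrr : rᵀ * r = 1 := by
    calc rᵀ * r = (P * r)ᵀ * (P * r) := by
          rw [transpose_mul, Matrix.mul_assoc, ← Matrix.mul_assoc Pᵀ, hP, Matrix.one_mul]
      _ = 1 := by
          rw [← hr, transpose_mul, Matrix.mul_assoc, ← Matrix.mul_assoc Zᵀ, hZ, Matrix.one_mul, hP]
  have hrr' : r * rᵀ = 1 := mul_eq_one_comm.1 hrr
  have hPZ : Pᵀ * Z = r * Pᵀ := by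
    have h1 : Zᵀ * P = P * rᵀ := by
      calc Zᵀ * P = Zᵀ * (P * r) * rᵀ := by
            rw [Matrix.mul_assoc, Matrix.mul_assoc, hrr', Matrix.mul_one]
        _ = P * rᵀ := by rw [← hr, ← Matrix.mul_assoc, hZ, Matrix.one_mul]
    simpa using congrArg Matrix.transpose h1
  have hPZG : Pᵀ * (Z * G) = 0 := by rw [← Matrix.mul_assoc, hPZ, Matrix.mul_assoc, hPG,
    Matrix.mul_zero]
  have hdec : Z = P * r * Pᵀ + G * (Gᵀ * Z * G) * Gᵀ := by
    have h1 : Z * G = G * (Gᵀ * Z * G) := by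
      calc Z * G = (P * Pᵀ + G * Gᵀ) * (Z * G) := by rw [hs, Matrix.one_mul]
        _ = _ := by
          rw [Matrix.add_mul, Matrix.mul_assoc, hPZG, Matrix.mul_zero, zero_add]
          simp only [Matrix.mul_assoc]
    calc Z = Z * (P * Pᵀ + G * Gᵀ) := by rw [hs, Matrix.mul_one]
      _ = _ := by rw [Matrix.mul_add, ← Matrix.mul_assoc, hr, ← Matrix.mul_assoc, h1]
  refine ⟨hrr, ?_, hdec, ?_⟩
  · calc (Gᵀ * Z * G)ᵀ * (Gᵀ * Z * G) = (Z * G)ᵀ * (G * Gᵀ) * (Z * G) := by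
          simp [transpose_mul, Matrix.mul_assoc]
      _ = (Z * G)ᵀ * (1 - P * Pᵀ) * (Z * G) := by rw [← hs]; simp
      _ = (Z * G)ᵀ * (Z * G) := by
          rw [Matrix.mul_sub, Matrix.sub_mul, Matrix.mul_one, Matrix.mul_assoc _ (P * Pᵀ),
            Matrix.mul_assoc P, hPZG]
          simp
      _ = 1 := by
          rw [transpose_mul, Matrix.mul_assoc, ← Matrix.mul_assoc Zᵀ, hZ, Matrix.one_mul, hG]
  · conv_lhs => rw [hdec, ← fromCols_mul_fromBlocks_mul_transpose]
    rw [det_conj_of_mul_eq_one (fromCols_mul_transpose_self hs)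
      (transpose_mul_self_fromCols hP hG hPG), det_fromBlocks_zero₂₁]

theorem conj_mul_conj {g : Matrix ι κ ℝ} (h1 : gᵀ * g = 1) (X Y : Matrix κ κ ℝ) :
    g * X * gᵀ * (g * Y * gᵀ) = g * (X * Y) * gᵀ := by
  calc g * X * gᵀ * (g * Y * gᵀ) = g * X * (gᵀ * g) * Y * gᵀ := by simp only [Matrix.mul_assoc]
    _ = _ := by rw [h1, Matrix.mul_one, Matrix.mul_assoc g X Y]

theorem exists_unit_mulVec_eq_zero {M : Matrix ι ι ℝ} (h : M.det = 0) :
    ∃ v : ι → ℝ, v ⬝ᵥ v = 1 ∧ M *ᵥ v = 0 := by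
  obtain ⟨v, hv, hM⟩ := exists_mulVec_eq_zero_iff.2 h
  have hpos : 0 < v ⬝ᵥ v := by
    have h1 : 0 ≤ v ⬝ᵥ v := Finset.sum_nonneg fun i _ => mul_self_nonneg _
    exact lt_of_le_of_ne h1 fun h2 => hv (dotProduct_self_eq_zero.1 h2.symm)
  refine ⟨(Real.sqrt (v ⬝ᵥ v))⁻¹ • v, ?_, by rw [mulVec_smul, hM, smul_zero]⟩
  have := Real.mul_self_sqrt hpos.le
  have h3 : Real.sqrt (v ⬝ᵥ v) ≠ 0 := (Real.sqrt_pos.2 hpos).ne'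
  rw [smul_dotProduct, dotProduct_smul, smul_eq_mul, smul_eq_mul]
  field_simp
  linarith [this]

/-- Since `h - c = h * (-c)(h - c)ᵀ` when `c² = 1`, the sign hypothesis makes the determinant equal
to its own negative. This is how a determinant forces an eigenvalue `±1`. -/
theorem det_sub_eq_zero_of_orthogonal {h : Matrix ι ι ℝ} (hh : hᵀ * h = 1) {c : ℝ}
    (hc : c * c = 1) (hdet : h.det * (-c) ^ Fintype.card ι = -1) : (h - c • 1).det = 0 := by
  have hh' : h * hᵀ = 1 := mul_eq_one_comm.1 hh
  have h1 : h - c • 1 = h * ((-c) • (h - c • 1)ᵀ) := by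
    rw [transpose_sub, transpose_smul, transpose_one, Matrix.mul_smul, mul_sub, hh',
      Matrix.mul_smul, mul_one, smul_sub, smul_smul]
    rw [show -c * c = -1 by linarith]
    module
  have h2 := congrArg Matrix.det h1
  rw [det_mul, det_smul, det_transpose, ← mul_assoc, hdet] at h2
  linarith

/-- A rotation of an even-dimensional space has an invariant plane on which it acts by a
rotation. -/
theorem exists_invariant_plane {m : ℕ} (hm : Fintype.card ι = 2 * (m + 1)) {Z : Matrix ι ι ℝ}
    (hZ : Zᵀ * Z = 1) (hdet : Z.det = 1) :
    ∃ (v w : ι → ℝ) (c s : ℝ), v ⬝ᵥ v = 1 ∧ w ⬝ᵥ w = 1 ∧ v ⬝ᵥ w = 0 ∧ c ^ 2 + s ^ 2 = 1 ∧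
      Z *ᵥ v = c • v + s • w ∧ Z *ᵥ w = -s • v + c • w := by
  have hZ' : Z * Zᵀ = 1 := mul_eq_one_comm.1 hZ
  have hne : Nonempty ι := Fintype.card_pos_iff.1 (by omega)
  have hH : (Z + Zᵀ).IsHermitian := by
    rw [Matrix.IsHermitian, conjTranspose_eq_transpose_of_trivial]
    simp [add_comm]
  -- An eigenvector of the symmetric matrix `Z + Zᵀ` satisfies `Z²v = l Zv - v`, so `v` and `Zv`
  -- span an invariant subspace.
  obtain ⟨v, l, hv, hl⟩ : ∃ (v : ι → ℝ) (l : ℝ), v ⬝ᵥ v = 1 ∧ (Z + Zᵀ) *ᵥ v = l • v := by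
    refine ⟨_, _, ?_, hH.mulVec_eigenvectorBasis hne.some⟩
    have h1 := hH.eigenvectorBasis.orthonormal.1 hne.some
    have h2 := real_inner_self_eq_norm_sq (hH.eigenvectorBasis hne.some)
    rw [h1, EuclideanSpace.inner_eq_star_dotProduct] at h2
    simpa using h2
  have hZv : (Z *ᵥ v) ⬝ᵥ (Z *ᵥ v) = 1 := by
    rw [dotProduct_mulVec, ← mulVec_transpose, mulVec_mulVec, hZ, one_mulVec, hv]
  set c := v ⬝ᵥ (Z *ᵥ v) with hc
  have hl2 : l = 2 * c := by
    have h1 : v ⬝ᵥ ((Z + Zᵀ) *ᵥ v) = l := by rw [hl, dotProduct_smul, hv]; simp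
    rw [add_mulVec, dotProduct_add, mulVec_transpose, dotProduct_comm v (v ᵥ* Z),
      ← dotProduct_mulVec] at h1
    linarith
  have hZZ : Z *ᵥ (Z *ᵥ v) = l • (Z *ᵥ v) - v := by
    have h1 : Z *ᵥ ((Z + Zᵀ) *ᵥ v) = l • (Z *ᵥ v) := by rw [hl, mulVec_smul]
    rw [add_mulVec, mulVec_add, mulVec_mulVec v Z Zᵀ, hZ', one_mulVec] at h1
    rw [← h1]; abel
  set u := Z *ᵥ v - c • v with hu
  have hvu : v ⬝ᵥ u = 0 := by
    rw [hu, dotProduct_sub, dotProduct_smul, hv, ← hc]; simp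
  have huu : u ⬝ᵥ u = 1 - c ^ 2 := by
    have h1 : u ⬝ᵥ u = (Z *ᵥ v) ⬝ᵥ u - c • (v ⬝ᵥ u) := by
      conv_lhs => rw [hu]
      rw [sub_dotProduct, smul_dotProduct]
    rw [h1, hvu, hu, dotProduct_sub, hZv, dotProduct_smul, dotProduct_comm, ← hc]
    simp only [smul_eq_mul]
    ring
  -- If `u = 0`, then `v` is an eigenvector with eigenvalue `c = ±1`. On its odd-dimensional
  -- complement `Z` has determinant `c`, which forces a second eigenvector for `c`; the rotation is
  -- then the scalar `c`.
  by_cases hu0 : u = 0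
  · have hcc : c * c = 1 := by
      rw [hu0] at huu
      simp at huu
      nlinarith
    have hZvc : Z *ᵥ v = c • v := sub_eq_zero.1 hu0
    set P : Matrix ι Unit ℝ := Matrix.of fun i _ => v i with hP
    have hPP : Pᵀ * P = 1 := by
      ext i j
      simpa [hP, mul_apply, dotProduct] using hv
    obtain ⟨G, hG, hPG, hs⟩ := exists_orthonormal_completion (μ := Fin (2 * m + 1)) hPP
      (by simp; omega)
    have hr : Z * P = P * (c • (1 : Matrix Unit Unit ℝ)) := by
      ext i j
      have := congrFun hZvc i
      simpa [hP, mul_apply, mulVec, dotProduct, mul_comm] using this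
    obtain ⟨-, hhh, hdec, hd⟩ := orthogonal_block_decomposition hZ hPP hG hPG hs hr
    set h := Gᵀ * Z * G with hh
    have hdh : h.det = c := by
      rw [hdet] at hd
      simp at hd
      have : c * (c * h.det) = c := by rw [← hd, mul_one]
      rw [← mul_assoc, hcc, one_mul] at this
      exact this
    obtain ⟨y, hy, hy0⟩ := exists_unit_mulVec_eq_zero
      (det_sub_eq_zero_of_orthogonal hhh hcc (by
        rw [hdh, Fintype.card_fin, pow_succ, pow_mul, neg_sq, pow_two, hcc, one_pow]
        linarith))
    have hPGy : Pᵀ *ᵥ (G *ᵥ y) = 0 := by rw [mulVec_mulVec, hPG, zero_mulVec]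
    refine ⟨v, G *ᵥ y, c, 0, hv, ?_, ?_, by nlinarith, by simpa using hZvc, ?_⟩
    · rw [dotProduct_mulVec, ← mulVec_transpose, mulVec_mulVec, hG, one_mulVec, hy]
    · have := congrFun hPGy ()
      simpa [hP, mulVec, dotProduct] using this
    · rw [sub_mulVec, smul_mulVec, one_mulVec, sub_eq_zero] at hy0
      conv_lhs => rw [hdec]
      rw [add_mulVec, ← mulVec_mulVec, hPGy, mulVec_zero, zero_add, mulVec_mulVec,
        Matrix.mul_assoc, hG, Matrix.mul_one, ← mulVec_mulVec, hy0, mulVec_smul]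
      simp
  · have hpos : 0 < u ⬝ᵥ u := by
      have h1 : 0 ≤ u ⬝ᵥ u := Finset.sum_nonneg fun i _ => mul_self_nonneg _
      exact lt_of_le_of_ne h1 fun h2 => hu0 (dotProduct_self_eq_zero.1 h2.symm)
    set s := Real.sqrt (u ⬝ᵥ u) with hs
    have hss : s * s = 1 - c ^ 2 := by rw [hs, Real.mul_self_sqrt hpos.le, huu]
    have hs0 : s ≠ 0 := (Real.sqrt_pos.2 hpos).ne'
    refine ⟨v, s⁻¹ • u, c, s, hv, ?_, ?_, by nlinarith, ?_, ?_⟩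
    · rw [smul_dotProduct, dotProduct_smul, huu, ← hss, smul_eq_mul, smul_eq_mul]
      field_simp
    · rw [dotProduct_smul, hvu, smul_zero]
    · rw [smul_smul, mul_inv_cancel₀ hs0, one_smul, hu]; abel
    · have h1 : Z *ᵥ u = c • u - (s * s) • v := by
        rw [hu, mulVec_sub, mulVec_smul, hZZ, hl2, hss]
        module
      rw [mulVec_smul, h1, smul_sub, smul_smul, smul_smul, inv_mul_cancel_left₀ hs0]
      module

theorem rotation_eq_mul_isGrassmannian {c s : ℝ} (h : c ^ 2 + s ^ 2 = 1) :
    IsGrassmannian 1 !![c, s; s, -c] ∧ IsGrassmannian 1 !![(1 : ℝ), 0; 0, -1] ∧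
      !![c, -s; s, c] = !![c, s; s, -c] * !![(1 : ℝ), 0; 0, -1] := by
  refine ⟨⟨?_, ?_, ?_⟩, ⟨?_, ?_, ?_⟩, ?_⟩
  · ext i j; fin_cases i <;> fin_cases j <;> simp
  · ext i j; fin_cases i <;> fin_cases j <;> simp [mul_apply, Fin.sum_univ_two] <;> nlinarith
  · simp [trace, Fin.sum_univ_two]
  · ext i j; fin_cases i <;> fin_cases j <;> simp
  · ext i j; fin_cases i <;> fin_cases j <;> simp [mul_apply, Fin.sum_univ_two]
  · simp [trace, Fin.sum_univ_two]
  · ext i j; fin_cases i <;> fin_cases j <;> simp [mul_apply, Fin.sum_univ_two]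

/-- A rotation of a `2m`-dimensional space is a product of two reflections in subspaces of
dimension `m`. -/
theorem exists_mul_isGrassmannian_of_det_eq_one (m : ℕ) {Z : Matrix ι ι ℝ}
    (hm : Fintype.card ι = 2 * m) (hZ : Zᵀ * Z = 1) (hdet : Z.det = 1) :
    ∃ X Y : Matrix ι ι ℝ, IsGrassmannian m X ∧ IsGrassmannian m Y ∧ Z = X * Y := by
  induction m generalizing ι with
  | zero =>
    have : IsEmpty ι := Fintype.card_eq_zero_iff.1 (by omega)
    exact ⟨1, 1, ⟨by simp, by simp, by simp⟩, ⟨by simp, by simp, by simp⟩,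
      Subsingleton.elim _ _⟩
  | succ m ih =>
    obtain ⟨v, w, c, s, hv, hw, hvw, hcs, hZv, hZw⟩ := exists_invariant_plane hm hZ hdet
    set P : Matrix ι (Fin 2) ℝ := Matrix.of fun i => ![v i, w i] with hP
    have hPP : Pᵀ * P = 1 := by
      have hwv : w ⬝ᵥ v = 0 := by rw [dotProduct_comm, hvw]
      ext i j
      fin_cases i <;> fin_cases j <;>
        simp [hP, mul_apply] <;> assumption
    have hr : Z * P = P * !![c, -s; s, c] := by
      ext i j
      have h1 := congrFun hZv i
      have h2 := congrFun hZw i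
      simp only [mulVec, dotProduct, Pi.add_apply, Pi.smul_apply, smul_eq_mul] at h1 h2
      fin_cases j
      · simp [hP, mul_apply, Fin.sum_univ_two, h1]; ring
      · simp [hP, mul_apply, Fin.sum_univ_two, h2]; ring
    obtain ⟨G, hG, hPG, hs⟩ := exists_orthonormal_completion (μ := Fin (2 * m)) hPP
      (by simp; omega)
    obtain ⟨-, hhh, hdec, hd⟩ := orthogonal_block_decomposition hZ hPP hG hPG hs hr
    have hrd : (!![c, -s; s, c] : Matrix (Fin 2) (Fin 2) ℝ).det = 1 := by
      rw [det_fin_two_of]; nlinarith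
    rw [hrd, one_mul, hdet] at hd
    obtain ⟨x, y, hx, hy, hxy⟩ := ih (by simp) hhh hd.symm
    obtain ⟨hx', hy', hxy'⟩ := rotation_eq_mul_isGrassmannian hcs
    have hg1 := transpose_mul_self_fromCols hPP hG hPG
    have hg2 := fromCols_mul_transpose_self hs
    have hcard : Fintype.card ι = Fintype.card (Fin 2 ⊕ Fin (2 * m)) := by simp; omega
    refine ⟨_, _, add_comm m 1 ▸ (hx'.fromBlocks hx).conj hg1 hg2 hcard,
      add_comm m 1 ▸ (hy'.fromBlocks hy).conj hg1 hg2 hcard, ?_⟩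
    rw [conj_mul_conj hg1, fromBlocks_multiply]
    simp only [Matrix.mul_zero, Matrix.zero_mul, add_zero, zero_add, ← hxy, ← hxy']
    rw [fromCols_mul_fromBlocks_mul_transpose]
    exact hdec

end Involutions

/-! ### Which orthogonal matrices are products of two reflections -/

section Products

open Matrix

variable {ι κ α β σ : Type} [Fintype ι] [DecidableEq ι] [Fintype κ] [DecidableEq κ]
  [Fintype α] [DecidableEq α] [Fintype β] [DecidableEq β] [Fintype σ] [DecidableEq σ]

/-- The submodule is moved to `EuclideanSpace`, where it has an orthonormal basis, and part of that
basis is kept. -/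
theorem exists_orthonormal_columns_mem (p : Submodule ℝ (ι → ℝ))
    (h : Fintype.card σ ≤ Module.finrank ℝ p) :
    ∃ G : Matrix ι σ ℝ, Gᵀ * G = 1 ∧ ∀ j, (fun i => G i j) ∈ p := by
  let e := (WithLp.linearEquiv 2 ℝ (ι → ℝ)).symm
  let p' : Submodule ℝ (EuclideanSpace ℝ ι) := p.map e.toLinearMap
  have hfr : Module.finrank ℝ p' = Module.finrank ℝ p :=
    LinearEquiv.finrank_map_eq e p
  let b := stdOrthonormalBasis ℝ p'
  let f : σ → Fin (Module.finrank ℝ p') := fun s =>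
    Fin.castLE (h.trans hfr.ge) (Fintype.equivFin σ s)
  have hf : Function.Injective f :=
    (Fin.castLE_injective _).comp (Fintype.equivFin σ).injective
  refine ⟨Matrix.of fun i s => (b (f s)).1.ofLp i, ?_, fun s => ?_⟩
  · ext s s'
    have h1 := orthonormal_iff_ite.1 b.orthonormal (f s') (f s)
    rw [Submodule.coe_inner, EuclideanSpace.inner_eq_star_dotProduct] at h1
    simp only [mul_apply, transpose_apply, of_apply, one_apply]
    simp only [dotProduct, Pi.star_apply, star_trivial] at h1
    rw [h1]
    simp only [hf.eq_iff, eq_comm]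
  · obtain ⟨x, hx, hxe⟩ := (b (f s)).2
    have : (fun i => (b (f s)).1.ofLp i) = x := by
      rw [← hxe]; rfl
    simp only [of_apply, this]
    exact hx

theorem exists_orthonormal_columns_mul_eq_zero (L : Matrix κ ι ℝ)
    (h : Fintype.card κ + Fintype.card σ ≤ Fintype.card ι) :
    ∃ G : Matrix ι σ ℝ, Gᵀ * G = 1 ∧ L * G = 0 := by
  have h1 := LinearMap.finrank_range_add_finrank_ker L.mulVecLin
  have h2 : Module.finrank ℝ (LinearMap.range L.mulVecLin) ≤ Fintype.card κ := by
    simpa using Submodule.finrank_le (LinearMap.range L.mulVecLin)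
  rw [Module.finrank_fintype_fun_eq_card] at h1
  obtain ⟨G, hG, hm⟩ := exists_orthonormal_columns_mem (σ := σ) (LinearMap.ker L.mulVecLin)
    (by omega)
  refine ⟨G, hG, ?_⟩
  ext i j
  have := congrFun (LinearMap.mem_ker.1 (hm j)) i
  simpa [mulVec, dotProduct, mul_apply] using this

theorem exists_orthonormal_columns_of_mul_eq_neg {Z : Matrix ι ι ℝ} {N L : Matrix ι β ℝ}
    (hL : Lᵀ * N = 1) (hN : Z * N = -N) : ∃ G : Matrix ι β ℝ, Gᵀ * G = 1 ∧ Z * G = -G := by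
  have hinj : Function.Injective N.mulVecLin := by
    intro x y hxy
    have := congrArg (fun z => Lᵀ *ᵥ z) hxy
    simpa [hL] using this
  obtain ⟨G, hG, hm⟩ := exists_orthonormal_columns_mem (σ := β) (LinearMap.range N.mulVecLin)
    (by rw [LinearMap.finrank_range_of_inj hinj]; simp)
  refine ⟨G, hG, ?_⟩
  ext i j
  obtain ⟨x, hx⟩ := hm j
  have h1 : Z *ᵥ (fun i => G i j) = -(fun i => G i j) := by
    rw [← hx, mulVecLin_apply, mulVec_mulVec, hN, neg_mulVec]
  simpa [mulVec, dotProduct, mul_apply] using congrFun h1 i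

/-- Eigenspaces of a product of two reflections. -/
theorem IsGrassmannian.mul_eigenspaces {c : ℕ} {X Y : Matrix ι ι ℝ}
    (hX : IsGrassmannian (c + Fintype.card β) X) (hY : IsGrassmannian c Y)
    (hc : Fintype.card ι = 2 * c + Fintype.card β + Fintype.card α) :
    (X * Y)ᵀ * (X * Y) = 1 ∧ (X * Y).det = (-1) ^ Fintype.card β ∧
      (∃ G : Matrix ι α ℝ, Gᵀ * G = 1 ∧ X * Y * G = G) ∧
      ∃ G : Matrix ι β ℝ, Gᵀ * G = 1 ∧ X * Y * G = -G := by
  refine ⟨?_, ?_, ?_, ?_⟩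
  · rw [transpose_mul, hX.symm, hY.symm, mul_assoc, ← mul_assoc X, hX.sq, one_mul, hY.sq]
  · rw [det_mul, hX.det, hY.det, ← pow_add]
    have : Fintype.card ι + (c + Fintype.card β) + (Fintype.card ι + c)
      = 2 * (Fintype.card ι + c) + Fintype.card β := by ring
    rw [this, pow_add, pow_mul]
    simp
  · obtain ⟨Q, hQ, hXQ⟩ := hX.exists_frame (σ := Fin (c + Fintype.card β)) (by simp)
    obtain ⟨R, hR, hYR⟩ := hY.exists_frame (σ := Fin c) (by simp)
    -- Vectors orthogonal to both fixed spaces are negated by `X` and by `Y`, hence fixed by the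
    -- product.
    obtain ⟨G, hG, hL⟩ := exists_orthonormal_columns_mul_eq_zero (σ := α) (fromRows Qᵀ Rᵀ)
      (by simp; omega)
    rw [fromRows_mul] at hL
    have hQG : Qᵀ * G = 0 := by
      have := congrArg toRows₁ hL
      rw [toRows₁_fromRows] at this
      exact this
    have hRG : Rᵀ * G = 0 := by
      have := congrArg toRows₂ hL
      rw [toRows₂_fromRows] at this
      exact this
    refine ⟨G, hG, ?_⟩
    have h1 : X * G = -G := by
      rw [hXQ, Matrix.sub_mul, Matrix.smul_mul, Matrix.mul_assoc, hQG]; simp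
    have h2 : Y * G = -G := by
      rw [hYR, Matrix.sub_mul, Matrix.smul_mul, Matrix.mul_assoc, hRG]; simp
    rw [Matrix.mul_assoc, h2, Matrix.mul_neg, h1, neg_neg]
  · obtain ⟨Q, hQ, hXQ⟩ := hX.exists_frame (σ := Fin (c + Fintype.card β)) (by simp)
    obtain ⟨R, hR, hYR⟩ := hY.exists_frame (σ := Fin c) (by simp)
    -- Vectors fixed by `X` and orthogonal to the fixed space of `Y`: `c` equations in `c + card β`
    -- unknowns.
    obtain ⟨G, hG, hL⟩ := exists_orthonormal_columns_mul_eq_zero (σ := β) (Rᵀ * Q) (by simp)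
    rw [Matrix.mul_assoc] at hL
    refine ⟨Q * G, ?_, ?_⟩
    · rw [transpose_mul, Matrix.mul_assoc, ← Matrix.mul_assoc Qᵀ, hQ, Matrix.one_mul, hG]
    have h1 : X * (Q * G) = Q * G := by
      rw [hXQ, Matrix.sub_mul, Matrix.smul_mul, Matrix.mul_assoc, ← Matrix.mul_assoc Qᵀ, hQ,
        Matrix.one_mul, Matrix.one_mul]
      module
    have h2 : Y * (Q * G) = -(Q * G) := by
      rw [hYR, Matrix.sub_mul, Matrix.smul_mul, Matrix.mul_assoc, hL]; simp
    rw [Matrix.mul_assoc X, h2, Matrix.mul_neg, h1]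

/-- Block decomposition of an orthogonal matrix with prescribed eigenvectors for `1` and `-1`. -/
theorem exists_adapted_frame {Z : Matrix ι ι ℝ} (hZ : Zᵀ * Z = 1)
    (hdet : Z.det = (-1) ^ Fintype.card β)
    (hc : Fintype.card ι = Fintype.card κ + Fintype.card β + Fintype.card α)
    {G₂ : Matrix ι α ℝ} {G₃ : Matrix ι β ℝ} (h2 : G₂ᵀ * G₂ = 1) (h3 : G₃ᵀ * G₃ = 1)
    (hZ2 : Z * G₂ = G₂) (hZ3 : Z * G₃ = -G₃) :
    ∃ (G₁ : Matrix ι κ ℝ) (h : Matrix κ κ ℝ), G₁ᵀ * G₁ = 1 ∧ (fromCols G₂ G₃)ᵀ * G₁ = 0 ∧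
      (fromCols G₂ G₃)ᵀ * fromCols G₂ G₃ = 1 ∧
      fromCols G₂ G₃ * (fromCols G₂ G₃)ᵀ + G₁ * G₁ᵀ = 1 ∧ hᵀ * h = 1 ∧ h.det = 1 ∧
      Z = fromCols G₂ G₃ * Matrix.fromBlocks (1 : Matrix α α ℝ) 0 0 (-1 : Matrix β β ℝ) * (fromCols G₂ G₃)ᵀ + G₁ * h * G₁ᵀ := by
  -- Eigenvectors of an orthogonal matrix for `1` and `-1` are orthogonal.
  have h23 : G₂ᵀ * G₃ = 0 := by
    have h4 : G₂ᵀ * G₃ = -(G₂ᵀ * G₃) := by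
      conv_lhs => rw [← hZ2, transpose_mul, Matrix.mul_assoc,
        show G₃ = -(Z * G₃) by rw [hZ3, neg_neg], Matrix.mul_neg, ← Matrix.mul_assoc Zᵀ, hZ,
        Matrix.one_mul, Matrix.mul_neg]
    ext i j
    have := congrFun (congrFun h4 i) j
    simp only [Matrix.neg_apply] at this
    simp only [Matrix.zero_apply]
    linarith
  have hP := transpose_mul_self_fromCols h2 h3 h23
  have hr : Z * fromCols G₂ G₃ = fromCols G₂ G₃ * Matrix.fromBlocks (1 : Matrix α α ℝ) 0 0 (-1 : Matrix β β ℝ) := by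
    rw [mul_fromCols, fromCols_mul_fromBlocks, hZ2, hZ3]
    simp
  obtain ⟨G₁, hG, hPG, hs⟩ := exists_orthonormal_completion (μ := κ) hP (by simp; omega)
  obtain ⟨-, hh, hdec, hd⟩ := orthogonal_block_decomposition hZ hP hG hPG hs hr
  refine ⟨G₁, _, hG, hPG, hP, hs, hh, ?_, hdec⟩
  rw [hdet, det_fromBlocks_zero₂₁, det_one, one_mul, det_neg, det_one, mul_one] at hd
  have h5 : ((-1 : ℝ) ^ Fintype.card β) * (-1) ^ Fintype.card β = 1 := by
    rw [← mul_pow]; simp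
  calc (G₁ᵀ * Z * G₁).det
      = ((-1 : ℝ) ^ Fintype.card β * (-1) ^ Fintype.card β) * (G₁ᵀ * Z * G₁).det := by
        rw [h5, one_mul]
    _ = 1 := by rw [mul_assoc, ← hd, h5]

/-- Criterion for an orthogonal matrix to be a product of two reflections of given types. -/
theorem exists_mul_isGrassmannian {c : ℕ} {Z : Matrix ι ι ℝ} (hZ : Zᵀ * Z = 1)
    (hdet : Z.det = (-1) ^ Fintype.card β)
    (hc : Fintype.card ι = 2 * c + Fintype.card β + Fintype.card α)
    {G₂ : Matrix ι α ℝ} {G₃ : Matrix ι β ℝ} (h2 : G₂ᵀ * G₂ = 1) (h3 : G₃ᵀ * G₃ = 1)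
    (hZ2 : Z * G₂ = G₂) (hZ3 : Z * G₃ = -G₃) :
    ∃ X Y : Matrix ι ι ℝ, IsGrassmannian (c + Fintype.card β) X ∧ IsGrassmannian c Y ∧
      Z = X * Y := by
  obtain ⟨G₁, h, hG, hPG, hP, hs, hh, hd, hdec⟩ :=
    exists_adapted_frame (κ := Fin (2 * c)) hZ hdet (by simp; omega) h2 h3 hZ2 hZ3
  obtain ⟨x, y, hx, hy, hxy⟩ := exists_mul_isGrassmannian_of_det_eq_one c (by simp) hh hd
  have hg1 := transpose_mul_self_fromCols hP hG hPG
  have hg2 := fromCols_mul_transpose_self hs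
  have hcard : Fintype.card ι = Fintype.card ((α ⊕ β) ⊕ Fin (2 * c)) := by simp; omega
  -- On the blocks `α`, `β`, `Fin (2 * c)` the factors are `(-1, 1, x)` and `(-1, -1, y)`, with
  -- product `(1, -1, h)`.
  have hX := ((((isGrassmannian_neg_one (ι := α)).fromBlocks
    (isGrassmannian_one (ι := β))).fromBlocks hx).conj hg1 hg2 hcard)
  have hY := (((isGrassmannian_neg_one (ι := α ⊕ β)).fromBlocks hy).conj hg1 hg2 hcard)
  rw [show 0 + Fintype.card β + c = c + Fintype.card β by omega] at hX
  rw [zero_add] at hY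
  refine ⟨_, _, hX, hY, ?_⟩
  rw [conj_mul_conj hg1, fromBlocks_multiply]
  have hneg : Matrix.fromBlocks (-1 : Matrix α α ℝ) 0 0 (1 : Matrix β β ℝ) * -1
      = Matrix.fromBlocks (1 : Matrix α α ℝ) 0 0 (-1 : Matrix β β ℝ) := by
    rw [mul_neg, mul_one, Matrix.fromBlocks_neg]
    simp
  simp only [Matrix.mul_zero, Matrix.zero_mul, add_zero, zero_add, ← hxy, hneg]
  rwa [fromCols_mul_fromBlocks_mul_transpose]

end Products

/-! ### Cayley transforms combined with reflections -/

section Parametrization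

open Matrix

variable {ι κ α β : Type} [Fintype ι] [DecidableEq ι] [Fintype κ] [DecidableEq κ]
  [Fintype α] [DecidableEq α] [Fintype β] [DecidableEq β]

/-- For `v` in the kernel, pairing with `v` kills the skew part and leaves `|Mᵀv|² = 0`; the right
inverse of `M` makes `Mᵀ` injective. -/
theorem isUnit_det_skew_add_gram {A : Matrix κ κ ℝ} (hA : Aᵀ = -A) {M : Matrix κ ι ℝ}
    {R : Matrix ι κ ℝ} (hR : M * R = 1) : IsUnit (A + M * Mᵀ).det := by
  rw [isUnit_iff_ne_zero]
  intro h
  obtain ⟨v, hv, hv0⟩ := exists_mulVec_eq_zero_iff.2 h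
  refine hv ?_
  have h1 : v ⬝ᵥ (A *ᵥ v) = 0 := by
    have h2 : v ⬝ᵥ (A *ᵥ v) = -(v ⬝ᵥ (A *ᵥ v)) := by
      conv_lhs => rw [dotProduct_mulVec, ← mulVec_transpose, hA, neg_mulVec, neg_dotProduct,
        dotProduct_comm]
    linarith
  have h3 : (Mᵀ *ᵥ v) ⬝ᵥ (Mᵀ *ᵥ v) = 0 := by
    have h4 := congrArg (fun w => v ⬝ᵥ w) hv0
    simp only [add_mulVec, dotProduct_add, h1, zero_add, dotProduct_zero] at h4
    rw [← h4, ← mulVec_mulVec, dotProduct_mulVec v M, ← mulVec_transpose]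
  have h5 := dotProduct_self_eq_zero.1 h3
  calc v = (M * R)ᵀ *ᵥ v := by rw [hR, transpose_one, one_mulVec]
    _ = 0 := by rw [transpose_mul, ← mulVec_mulVec, h5, mulVec_zero]

theorem isUnit_det_gram {M : Matrix κ ι ℝ} {R : Matrix ι κ ℝ} (hR : M * R = 1) :
    IsUnit (M * Mᵀ).det := by
  have := isUnit_det_skew_add_gram (A := 0) (by simp) hR
  rwa [zero_add] at this

/-- The orthogonal matrix acting by `-1` on the columns of `N`, by a Cayley transform on the rows
of `M`, and trivially on the orthogonal complement of both. -/
noncomputable def cayleyReflection (A : Matrix κ κ ℝ) (M : Matrix κ ι ℝ) (N : Matrix ι β ℝ) :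
    Matrix ι ι ℝ :=
  1 - (2 : ℝ) • (Mᵀ * (A + M * Mᵀ)⁻¹ * M) - (2 : ℝ) • (N * (Nᵀ * N)⁻¹ * Nᵀ)

/-- A change of row basis is absorbed by a congruence of `A`, which preserves skewness. Together
with `cayleyReflection_mul_right` this allows `M` and `N` to be normalised. -/
theorem cayleyReflection_mul_left (A : Matrix κ κ ℝ) (M : Matrix κ ι ℝ) (N : Matrix ι β ℝ)
    {P : Matrix κ κ ℝ} (hP : IsUnit P.det) :
    cayleyReflection A (P * M) N = cayleyReflection (P⁻¹ * A * (P⁻¹)ᵀ) M N := by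
  have h1 := mul_nonsing_inv P hP
  have h2 := nonsing_inv_mul P hP
  have h2' : Pᵀ⁻¹ * Pᵀ = 1 := nonsing_inv_mul _ (by rwa [det_transpose])
  have h3 : A + P * M * (P * M)ᵀ = P * (P⁻¹ * A * (P⁻¹)ᵀ + M * Mᵀ) * Pᵀ := by
    have : P * (P⁻¹ * A * (P⁻¹)ᵀ) * Pᵀ = (P * P⁻¹) * A * (P * P⁻¹)ᵀ := by
      simp only [transpose_mul, Matrix.mul_assoc]
    rw [Matrix.mul_add, Matrix.add_mul, this, h1, transpose_one, Matrix.one_mul, Matrix.mul_one]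
    simp only [transpose_mul, Matrix.mul_assoc]
  unfold cayleyReflection
  rw [h3, Matrix.mul_inv_rev, Matrix.mul_inv_rev]
  have h4 : (P * M)ᵀ * (Pᵀ⁻¹ * ((P⁻¹ * A * (P⁻¹)ᵀ + M * Mᵀ)⁻¹ * P⁻¹)) * (P * M)
      = Mᵀ * (P⁻¹ * A * (P⁻¹)ᵀ + M * Mᵀ)⁻¹ * M := by
    have h5 : Pᵀ * Pᵀ⁻¹ = 1 := mul_nonsing_inv _ (by rwa [det_transpose])
    calc _ = Mᵀ * (Pᵀ * Pᵀ⁻¹) * (P⁻¹ * A * (P⁻¹)ᵀ + M * Mᵀ)⁻¹ * (P⁻¹ * P) * M := by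
          simp only [transpose_mul, Matrix.mul_assoc]
      _ = _ := by rw [h5, h2, Matrix.mul_one, Matrix.mul_one]
  rw [h4]

theorem cayleyReflection_mul_right (A : Matrix κ κ ℝ) (M : Matrix κ ι ℝ) (N : Matrix ι β ℝ)
    {T : Matrix β β ℝ} (hT : IsUnit T.det) :
    cayleyReflection A M (N * T) = cayleyReflection A M N := by
  have h1 := mul_nonsing_inv T hT
  have h5 : Tᵀ⁻¹ * Tᵀ = 1 := nonsing_inv_mul _ (by rwa [det_transpose])
  have h3 : (N * T)ᵀ * (N * T) = Tᵀ * ((Nᵀ * N) * T) := by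
    simp only [transpose_mul, Matrix.mul_assoc]
  unfold cayleyReflection
  rw [h3, Matrix.mul_inv_rev, Matrix.mul_inv_rev]
  have h4 : N * T * (T⁻¹ * (Nᵀ * N)⁻¹ * Tᵀ⁻¹) * (N * T)ᵀ = N * (Nᵀ * N)⁻¹ * Nᵀ := by
    calc _ = N * (T * T⁻¹) * (Nᵀ * N)⁻¹ * (Tᵀ⁻¹ * Tᵀ) * Nᵀ := by
          simp only [transpose_mul, Matrix.mul_assoc]
      _ = _ := by rw [h1, h5, Matrix.mul_one, Matrix.mul_one]
  rw [h4]

/-- Sandwich `(A + B) + (-A + B) = 2B` between `Kᵀ` and `K`, where `K` is the inverse. This identity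
is the orthogonality of the Cayley factor. -/
theorem inv_add_transpose_inv {A B : Matrix κ κ ℝ} (hA : Aᵀ = -A) (hB : Bᵀ = B)
    (h : IsUnit (A + B).det) :
    (A + B)⁻¹ + ((A + B)⁻¹)ᵀ = (2 : ℝ) • (((A + B)⁻¹)ᵀ * B * (A + B)⁻¹) := by
  set K := (A + B)⁻¹
  have h1 : (A + B) * K = 1 := mul_nonsing_inv _ h
  have h2 : Kᵀ * (-A + B) = 1 := by
    have := congrArg Matrix.transpose h1
    rwa [transpose_mul, transpose_add, hA, hB, transpose_one] at this
  have h3 : (2 : ℝ) • (Kᵀ * B * K) = Kᵀ * ((A + B) * K) + Kᵀ * (-A + B) * K := by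
    rw [← Matrix.mul_assoc, ← Matrix.add_mul, ← Matrix.mul_add, ← Matrix.smul_mul,
      ← Matrix.mul_smul]
    congr 2
    module
  rw [h3, h1, h2, Matrix.mul_one, Matrix.one_mul, add_comm]

theorem inv_sub_transpose_inv {A B : Matrix κ κ ℝ} (hA : Aᵀ = -A) (hB : Bᵀ = B)
    (h : IsUnit (A + B).det) :
    (A + B)⁻¹ - ((A + B)⁻¹)ᵀ = -(2 : ℝ) • (((A + B)⁻¹)ᵀ * A * (A + B)⁻¹) := by
  set K := (A + B)⁻¹
  have h1 : (A + B) * K = 1 := mul_nonsing_inv _ h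
  have h2 : Kᵀ * (-A + B) = 1 := by
    have := congrArg Matrix.transpose h1
    rwa [transpose_mul, transpose_add, hA, hB, transpose_one] at this
  have h3 : -(2 : ℝ) • (Kᵀ * A * K) = Kᵀ * (-A + B) * K - Kᵀ * ((A + B) * K) := by
    rw [← Matrix.mul_assoc, ← Matrix.sub_mul, ← Matrix.mul_sub, ← Matrix.smul_mul,
      ← Matrix.mul_smul]
    congr 2
    module
  rw [h3, h1, h2, Matrix.mul_one, Matrix.one_mul]

section

variable {A : Matrix κ κ ℝ} {M : Matrix κ ι ℝ} {N : Matrix ι β ℝ}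

theorem cayley_orthogonal (hA : Aᵀ = -A) (h : IsUnit (A + M * Mᵀ).det) :
    (1 - (2 : ℝ) • (Mᵀ * (A + M * Mᵀ)⁻¹ * M))ᵀ * (1 - (2 : ℝ) • (Mᵀ * (A + M * Mᵀ)⁻¹ * M))
      = 1 := by
  have h1 := inv_add_transpose_inv hA (B := M * Mᵀ) (by simp) h
  set K := (A + M * Mᵀ)⁻¹
  have h2 : (1 - (2 : ℝ) • (Mᵀ * K * M))ᵀ * (1 - (2 : ℝ) • (Mᵀ * K * M))
      = 1 - (2 : ℝ) • (Mᵀ * (K + Kᵀ - (2 : ℝ) • (Kᵀ * (M * Mᵀ) * K)) * M) := by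
    simp only [transpose_sub, transpose_one, transpose_smul, transpose_mul, transpose_transpose,
      Matrix.mul_sub, Matrix.sub_mul, Matrix.mul_add, Matrix.add_mul, Matrix.mul_smul,
      Matrix.smul_mul, Matrix.one_mul, Matrix.mul_one, Matrix.mul_assoc]
    module
  rw [h2, h1, sub_self]
  simp

/-- Sylvester's identity reduces to size `κ`, where the matrix is `-K (A + MMᵀ)ᵀ` with `K` the
inverse of `A + MMᵀ`; the even size removes the sign. -/
theorem cayley_det (hA : Aᵀ = -A) (h : IsUnit (A + M * Mᵀ).det)
    (hκ : Even (Fintype.card κ)) : (1 - (2 : ℝ) • (Mᵀ * (A + M * Mᵀ)⁻¹ * M)).det = 1 := by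
  have h0 : (A + M * Mᵀ)⁻¹ * (A + M * Mᵀ) = 1 := nonsing_inv_mul _ h
  rw [← Matrix.smul_mul, ← Matrix.smul_mul, Matrix.mul_assoc, det_one_sub_mul_comm]
  have h2 : 1 - (A + M * Mᵀ)⁻¹ * M * (2 : ℝ) • Mᵀ = (A + M * Mᵀ)⁻¹ * (-(A + M * Mᵀ)ᵀ) := by
    have h3 : -(A + M * Mᵀ)ᵀ = (A + M * Mᵀ) - (2 : ℝ) • (M * Mᵀ) := by
      rw [transpose_add, hA, transpose_mul, transpose_transpose]
      module
    rw [h3, Matrix.mul_sub, h0, Matrix.mul_smul, Matrix.mul_smul, Matrix.mul_assoc]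
  rw [h2, det_mul, det_neg, det_transpose, hκ.neg_one_pow, one_mul, ← det_mul, h0, det_one]

theorem reflection_orthogonal (h : IsUnit (Nᵀ * N).det) :
    (1 - (2 : ℝ) • (N * (Nᵀ * N)⁻¹ * Nᵀ))ᵀ * (1 - (2 : ℝ) • (N * (Nᵀ * N)⁻¹ * Nᵀ)) = 1 := by
  have h1 : (Nᵀ * N)⁻¹ * (Nᵀ * N) = 1 := nonsing_inv_mul _ h
  have h2 : ((Nᵀ * N)⁻¹)ᵀ = (Nᵀ * N)⁻¹ := by
    rw [transpose_nonsing_inv, transpose_mul, transpose_transpose]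
  have h3 : N * (Nᵀ * N)⁻¹ * Nᵀ * (N * (Nᵀ * N)⁻¹ * Nᵀ) = N * (Nᵀ * N)⁻¹ * Nᵀ := by
    calc _ = N * ((Nᵀ * N)⁻¹ * (Nᵀ * N)) * (Nᵀ * N)⁻¹ * Nᵀ := by simp only [Matrix.mul_assoc]
      _ = _ := by rw [h1, Matrix.mul_one]
  have h4 : (N * (Nᵀ * N)⁻¹ * Nᵀ)ᵀ = N * (Nᵀ * N)⁻¹ * Nᵀ := by
    rw [transpose_mul, transpose_mul, h2, transpose_transpose, Matrix.mul_assoc]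
  rw [transpose_sub, transpose_smul, h4, transpose_one]
  simp only [Matrix.mul_sub, Matrix.sub_mul, Matrix.mul_smul, Matrix.smul_mul, h3,
    Matrix.one_mul, Matrix.mul_one]
  module

theorem reflection_det (h : IsUnit (Nᵀ * N).det) :
    (1 - (2 : ℝ) • (N * (Nᵀ * N)⁻¹ * Nᵀ)).det = (-1) ^ Fintype.card β := by
  have h1 : (Nᵀ * N)⁻¹ * (Nᵀ * N) = 1 := nonsing_inv_mul _ h
  rw [Matrix.mul_assoc, ← Matrix.smul_mul, det_one_sub_mul_comm, Matrix.mul_smul,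
    Matrix.mul_assoc, h1]
  have : (1 : Matrix β β ℝ) - (2 : ℝ) • 1 = -1 := by module
  rw [this, det_neg, det_one, mul_one]

theorem cayleyReflection_eq_mul (hMN : M * N = 0) :
    cayleyReflection A M N = (1 - (2 : ℝ) • (Mᵀ * (A + M * Mᵀ)⁻¹ * M))
      * (1 - (2 : ℝ) • (N * (Nᵀ * N)⁻¹ * Nᵀ)) := by
  have h : Mᵀ * (A + M * Mᵀ)⁻¹ * M * (N * (Nᵀ * N)⁻¹ * Nᵀ) = 0 := by
    calc _ = Mᵀ * (A + M * Mᵀ)⁻¹ * (M * N) * (Nᵀ * N)⁻¹ * Nᵀ := by simp only [Matrix.mul_assoc]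
      _ = 0 := by rw [hMN]; simp
  simp only [cayleyReflection, Matrix.mul_sub, Matrix.sub_mul, Matrix.mul_smul, Matrix.smul_mul,
    h, Matrix.one_mul, Matrix.mul_one]
  module

/-- The eigenvalue criterion applies: vectors orthogonal to the rows of `M` and the columns of `N`
are fixed, and the columns of `N` are negated. -/
theorem cayleyReflection_mem {c : ℕ} (hκ : Fintype.card κ = 2 * c)
    (hc : Fintype.card ι = 2 * c + Fintype.card β + Fintype.card α)
    (hA : Aᵀ = -A) {R : Matrix ι κ ℝ} (hR : M * R = 1) {L : Matrix ι β ℝ} (hL : Lᵀ * N = 1)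
    (hMN : M * N = 0) :
    ∃ X Y : Matrix ι ι ℝ, IsGrassmannian (c + Fintype.card β) X ∧ IsGrassmannian c Y ∧
      cayleyReflection A M N = X * Y := by
  have hu := isUnit_det_skew_add_gram hA hR
  have hN : IsUnit (Nᵀ * N).det := by
    have := isUnit_det_gram (M := Nᵀ) (R := L) (by simpa using congrArg Matrix.transpose hL)
    rwa [transpose_transpose] at this
  have hZ : (cayleyReflection A M N)ᵀ * cayleyReflection A M N = 1 := by
    rw [cayleyReflection_eq_mul hMN, transpose_mul, Matrix.mul_assoc, ← Matrix.mul_assoc _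
      (1 - (2 : ℝ) • (Mᵀ * (A + M * Mᵀ)⁻¹ * M)), cayley_orthogonal hA hu, Matrix.one_mul,
      reflection_orthogonal hN]
  have hdet : (cayleyReflection A M N).det = (-1) ^ Fintype.card β := by
    rw [cayleyReflection_eq_mul hMN, det_mul, cayley_det hA hu (by rw [hκ]; simp),
      reflection_det hN, one_mul]
  obtain ⟨G₂, h2, h2'⟩ := exists_orthonormal_columns_mul_eq_zero (σ := α) (fromRows M Nᵀ)
    (by simp; omega)
  rw [fromRows_mul] at h2'
  have hM2 : M * G₂ = 0 := by
    have := congrArg toRows₁ h2'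
    rw [toRows₁_fromRows] at this
    exact this
  have hN2 : Nᵀ * G₂ = 0 := by
    have := congrArg toRows₂ h2'
    rw [toRows₂_fromRows] at this
    exact this
  have hZN : cayleyReflection A M N * N = -N := by
    have h1 : N * (Nᵀ * N)⁻¹ * Nᵀ * N = N := by
      rw [Matrix.mul_assoc, Matrix.mul_assoc, nonsing_inv_mul _ hN, Matrix.mul_one]
    rw [cayleyReflection, Matrix.sub_mul, Matrix.sub_mul, Matrix.smul_mul, Matrix.smul_mul, h1,
      Matrix.mul_assoc, hMN, Matrix.one_mul, Matrix.mul_zero]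
    module
  obtain ⟨G₃, h3, h3'⟩ := exists_orthonormal_columns_of_mul_eq_neg hL hZN
  refine exists_mul_isGrassmannian hZ hdet hc h2 h3 ?_ h3'
  rw [cayleyReflection, Matrix.sub_mul, Matrix.sub_mul, Matrix.smul_mul, Matrix.smul_mul,
    Matrix.mul_assoc _ M, Matrix.mul_assoc _ Nᵀ, hM2, hN2]
  simp

end

end Parametrization

/-! ### Continuity of the matrix operations -/

section Continuity

open Matrix

variable {ι κ β σ T : Type} [Fintype ι] [DecidableEq ι] [Fintype κ] [DecidableEq κ]
  [Fintype β] [DecidableEq β] [TopologicalSpace T]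

theorem continuousAt_matrix_mul {f : T → Matrix ι κ ℝ} {g : T → Matrix κ β ℝ} {x : T}
    (hf : ContinuousAt f x) (hg : ContinuousAt g x) : ContinuousAt (fun t => f t * g t) x := by
  have h : Continuous fun p : Matrix ι κ ℝ × Matrix κ β ℝ => p.1 * p.2 :=
    continuous_fst.matrix_mul continuous_snd
  exact h.continuousAt.comp (hf.prodMk hg)

theorem continuousAt_matrix_transpose {f : T → Matrix ι κ ℝ} {x : T}
    (hf : ContinuousAt f x) : ContinuousAt (fun t => (f t)ᵀ) x :=
  (continuous_id.matrix_transpose (A := fun A : Matrix ι κ ℝ => A)).continuousAt.comp hf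

theorem continuousAt_inv_of_isUnit_det {f : T → Matrix κ κ ℝ} {x : T}
    (hf : ContinuousAt f x) (hx : IsUnit (f x).det) : ContinuousAt (fun t => (f t)⁻¹) x := by
  have h : ContinuousAt (fun A : Matrix κ κ ℝ => A⁻¹) (f x) := by
    simp only [Matrix.inv_def, Ring.inverse_eq_inv']
    exact ((continuous_id.matrix_det (A := fun A : Matrix κ κ ℝ => A)).continuousAt.inv₀
      hx.ne_zero).smul (continuous_id.matrix_adjugate (A := fun A : Matrix κ κ ℝ => A)).continuousAt
  exact ContinuousAt.comp (g := fun A : Matrix κ κ ℝ => A⁻¹) h hf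

theorem continuousAt_cayleyReflection {A : T → Matrix κ κ ℝ} {M : T → Matrix κ ι ℝ}
    {N : T → Matrix ι β ℝ} {x : T} (hA : ContinuousAt A x) (hM : ContinuousAt M x)
    (hN : ContinuousAt N x) (h1 : IsUnit (A x + M x * (M x)ᵀ).det)
    (h2 : IsUnit ((N x)ᵀ * N x).det) :
    ContinuousAt (fun t => cayleyReflection (A t) (M t) (N t)) x := by
  have hMt := continuousAt_matrix_transpose hM
  have hNt := continuousAt_matrix_transpose hN
  have hK := continuousAt_inv_of_isUnit_det (hA.add (continuousAt_matrix_mul hM hMt)) h1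
  have hG := continuousAt_inv_of_isUnit_det (continuousAt_matrix_mul hNt hN) h2
  exact (continuousAt_const.sub ((continuousAt_matrix_mul (continuousAt_matrix_mul hMt hK)
    hM).const_smul (2 : ℝ))).sub ((continuousAt_matrix_mul (continuousAt_matrix_mul hN hG)
    hNt).const_smul (2 : ℝ))

end Continuity

/-! ### The rational chart of the product set -/

section Chart

open Matrix

/-- Coordinates of the chart: a skew-symmetric matrix and two rectangular matrices. -/
abbrev ChartIndex (m b a : ℕ) : Type :=
  {p : Fin m × Fin m // p.1 < p.2} ⊕ (Fin m × (Fin b ⊕ Fin a)) ⊕ (Fin a × Fin b)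

variable {m b a : ℕ}

def skewCoord (t : ChartIndex m b a → ℝ) : Matrix (Fin m) (Fin m) ℝ := fun i j =>
  if h : i < j then t (Sum.inl ⟨(i, j), h⟩) else
    if h : j < i then -t (Sum.inl ⟨(j, i), h⟩) else 0

def rowCoord (t : ChartIndex m b a → ℝ) : Matrix (Fin m) (Fin b ⊕ Fin a) ℝ := fun i j =>
  t (Sum.inr (Sum.inl (i, j)))

def colCoord (t : ChartIndex m b a → ℝ) : Matrix (Fin a) (Fin b) ℝ := fun i j =>
  t (Sum.inr (Sum.inr (i, j)))

abbrev rowFrame (C : Matrix (Fin m) (Fin b ⊕ Fin a) ℝ) :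
    Matrix (Fin m) (Fin m ⊕ (Fin b ⊕ Fin a)) ℝ := fromCols (1 : Matrix (Fin m) (Fin m) ℝ) C

abbrev lowerFrame (D : Matrix (Fin a) (Fin b) ℝ) : Matrix (Fin b ⊕ Fin a) (Fin b) ℝ :=
  fromRows (1 : Matrix (Fin b) (Fin b) ℝ) D

/-- The matrix with lower part `(1, D)` and columns orthogonal to the rows of `(1, C)`. -/
def colFrame (C : Matrix (Fin m) (Fin b ⊕ Fin a) ℝ) (D : Matrix (Fin a) (Fin b) ℝ) :
    Matrix (Fin m ⊕ (Fin b ⊕ Fin a)) (Fin b) ℝ :=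
  fromRows (-(C * lowerFrame D)) (lowerFrame D)

/-- The identity blocks in the two frames remove the freedom of choosing bases, which is what makes
the parameters recoverable from the value. -/
noncomputable def chart (t : ChartIndex m b a → ℝ) :
    Matrix (Fin m ⊕ (Fin b ⊕ Fin a)) (Fin m ⊕ (Fin b ⊕ Fin a)) ℝ :=
  cayleyReflection (skewCoord t) (rowFrame (rowCoord t)) (colFrame (rowCoord t) (colCoord t))

theorem skewCoord_transpose (t : ChartIndex m b a → ℝ) : (skewCoord t)ᵀ = -skewCoord t := by
  ext i j
  rcases lt_trichotomy i j with h | h | h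
  · simp [skewCoord, h, h.not_gt]
  · simp [skewCoord, h]
  · simp [skewCoord, h, h.not_gt]

theorem exists_coord {A : Matrix (Fin m) (Fin m) ℝ} (hA : Aᵀ = -A)
    (C : Matrix (Fin m) (Fin b ⊕ Fin a) ℝ) (D : Matrix (Fin a) (Fin b) ℝ) :
    ∃ t : ChartIndex m b a → ℝ, skewCoord t = A ∧ rowCoord t = C ∧ colCoord t = D := by
  refine ⟨Sum.elim (fun p => A p.1.1 p.1.2) (Sum.elim (fun p => C p.1 p.2) fun p => D p.1 p.2),
    ?_, rfl, rfl⟩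
  have hA' : ∀ i j, A j i = -A i j := fun i j => congrFun (congrFun hA i) j
  ext i j
  rcases lt_trichotomy i j with h | h | h
  · simp [skewCoord, h]
  · subst h
    simp only [skewCoord, lt_self_iff_false, dite_false]
    linarith [hA' i i]
  · simp [skewCoord, h, h.not_gt, ← hA' j i]

theorem rowFrame_mul_colFrame (C : Matrix (Fin m) (Fin b ⊕ Fin a) ℝ)
    (D : Matrix (Fin a) (Fin b) ℝ) :
    rowFrame C * colFrame C D = 0 := by
  rw [colFrame, fromCols_mul_fromRows, Matrix.one_mul, neg_add_cancel (C * lowerFrame D)]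

theorem rowFrame_mul_rightInverse (C : Matrix (Fin m) (Fin b ⊕ Fin a) ℝ) :
    rowFrame C * fromRows (1 : Matrix (Fin m) (Fin m) ℝ)
      (0 : Matrix (Fin b ⊕ Fin a) (Fin m) ℝ) = 1 := by
  rw [fromCols_mul_fromRows]; simp

theorem leftInverse_mul_colFrame (C : Matrix (Fin m) (Fin b ⊕ Fin a) ℝ)
    (D : Matrix (Fin a) (Fin b) ℝ) :
    (fromRows (0 : Matrix (Fin m) (Fin b) ℝ) (lowerFrame (0 : Matrix (Fin a) (Fin b) ℝ)))ᵀ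
      * colFrame C D = 1 := by
  rw [colFrame, transpose_fromRows, fromCols_mul_fromRows, transpose_fromRows,
    fromCols_mul_fromRows]
  simp

theorem isUnit_det_rowFrame (C : Matrix (Fin m) (Fin b ⊕ Fin a) ℝ) :
    IsUnit (rowFrame C * (rowFrame C)ᵀ).det :=
  isUnit_det_gram (rowFrame_mul_rightInverse C)

theorem isUnit_det_colFrame (C : Matrix (Fin m) (Fin b ⊕ Fin a) ℝ)
    (D : Matrix (Fin a) (Fin b) ℝ) : IsUnit ((colFrame C D)ᵀ * colFrame C D).det := by
  have := isUnit_det_gram (M := (colFrame C D)ᵀ)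
    (by simpa using congrArg Matrix.transpose (leftInverse_mul_colFrame C D))
  rwa [transpose_transpose] at this

theorem isUnit_det_chart (t : ChartIndex m b a → ℝ) :
    IsUnit (skewCoord t + rowFrame (rowCoord t) * (rowFrame (rowCoord t))ᵀ).det :=
  isUnit_det_skew_add_gram (skewCoord_transpose t) (rowFrame_mul_rightInverse _)

theorem chart_mem {c : ℕ} (t : ChartIndex (2 * c) b a → ℝ) :
    ∃ X Y, IsGrassmannian (c + b) X ∧ IsGrassmannian c Y ∧ chart t = X * Y := by
  have := cayleyReflection_mem (c := c) (α := Fin a) (β := Fin b) (by simp) (by simp; omega)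
    (skewCoord_transpose t)
    (rowFrame_mul_rightInverse (rowCoord t)) (leftInverse_mul_colFrame (rowCoord t) (colCoord t))
    (rowFrame_mul_colFrame _ _)
  rwa [Fintype.card_fin] at this

theorem continuous_skewCoord : Continuous (skewCoord (m := m) (b := b) (a := a)) := by
  refine continuous_matrix fun i j => ?_
  unfold skewCoord
  split_ifs <;> fun_prop

theorem continuous_rowCoord : Continuous (rowCoord (m := m) (b := b) (a := a)) :=
  continuous_matrix fun i j => by unfold rowCoord; fun_prop

theorem continuous_colCoord : Continuous (colCoord (m := m) (b := b) (a := a)) :=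
  continuous_matrix fun i j => by unfold colCoord; fun_prop

theorem continuous_fromRows {T κ ι ι' : Type} [TopologicalSpace T] {f : T → Matrix ι κ ℝ}
    {g : T → Matrix ι' κ ℝ} (hf : Continuous f) (hg : Continuous g) :
    Continuous fun t => fromRows (f t) (g t) :=
  continuous_matrix fun i j => by
    rcases i with i | i
    · exact hf.matrix_elem i j
    · exact hg.matrix_elem i j

theorem continuous_fromCols {T κ ι ι' : Type} [TopologicalSpace T] {f : T → Matrix κ ι ℝ}
    {g : T → Matrix κ ι' ℝ} (hf : Continuous f) (hg : Continuous g) :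
    Continuous fun t => fromCols (f t) (g t) :=
  continuous_matrix fun i j => by
    rcases j with j | j
    · exact hf.matrix_elem i j
    · exact hg.matrix_elem i j

theorem continuous_chart : Continuous (chart (m := m) (b := b) (a := a)) := by
  rw [continuous_iff_continuousAt]
  intro t
  have hD : Continuous fun t : ChartIndex m b a → ℝ =>
      fromRows (1 : Matrix (Fin b) (Fin b) ℝ) (colCoord t) :=
    continuous_fromRows continuous_const continuous_colCoord
  exact continuousAt_cayleyReflection continuous_skewCoord.continuousAt
    (continuous_fromCols continuous_const continuous_rowCoord).continuousAt
    (continuous_fromRows (continuous_rowCoord.matrix_mul hD).neg hD).continuousAt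
    (isUnit_det_chart t) (isUnit_det_colFrame _ _)

/-! ### Density of the chart -/

section Closure

/-- Invertible leading blocks `P` and `T` can be divided out by changes of basis; the upper part of
`N` is then determined by `M * N = 0`. -/
theorem cayleyReflection_mem_range_chart {A : Matrix (Fin m) (Fin m) ℝ} (hA : Aᵀ = -A)
    {M : Matrix (Fin m) (Fin m ⊕ (Fin b ⊕ Fin a)) ℝ}
    {N : Matrix (Fin m ⊕ (Fin b ⊕ Fin a)) (Fin b) ℝ} (hMN : M * N = 0)
    (hM : IsUnit M.toCols₁.det) (hN : IsUnit N.toRows₂.toRows₁.det) :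
    cayleyReflection A M N ∈ Set.range (chart (m := m) (b := b) (a := a)) := by
  set P := M.toCols₁
  set T := N.toRows₂.toRows₁
  set C := P⁻¹ * M.toCols₂
  set D := N.toRows₂.toRows₂ * T⁻¹
  have hP := mul_nonsing_inv P hM
  have hP' := nonsing_inv_mul P hM
  have hT := nonsing_inv_mul T hN
  have hM' : M = P * rowFrame C := by
    rw [mul_fromCols, Matrix.mul_one, ← Matrix.mul_assoc, hP, Matrix.one_mul, fromCols_toCols]
  have hN2 : N.toRows₂ = lowerFrame D * T := by
    rw [fromRows_mul, Matrix.one_mul, Matrix.mul_assoc, hT, Matrix.mul_one, fromRows_toRows]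
  have hN1 : N.toRows₁ = -(C * lowerFrame D) * T := by
    have h1 : rowFrame C * N = 0 := by
      calc rowFrame C * N = P⁻¹ * (P * rowFrame C * N) := by
            rw [← Matrix.mul_assoc, ← Matrix.mul_assoc, hP', Matrix.one_mul]
        _ = 0 := by rw [← hM', hMN, Matrix.mul_zero]
    rw [← fromRows_toRows N, fromCols_mul_fromRows, Matrix.one_mul, hN2] at h1
    rw [Matrix.neg_mul, Matrix.mul_assoc]
    exact eq_neg_of_add_eq_zero_left h1
  have hN' : N = colFrame C D * T := by
    rw [colFrame, fromRows_mul, ← hN1, ← hN2, fromRows_toRows]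
  have hA' : (P⁻¹ * A * (P⁻¹)ᵀ)ᵀ = -(P⁻¹ * A * (P⁻¹)ᵀ) := by
    rw [transpose_mul, transpose_mul, hA, transpose_transpose]
    simp [Matrix.mul_assoc]
  obtain ⟨t, h1, h2, h3⟩ := exists_coord hA' C D
  refine ⟨t, ?_⟩
  rw [chart, h1, h2, h3, ← cayleyReflection_mul_left _ _ _ hM, ← hM',
    ← cayleyReflection_mul_right _ _ _ hN, ← hN']

open Filter Topology in
-- The determinant is the characteristic polynomial of `-T` at `r`, which has finitely many roots.
theorem eventually_isUnit_det_add_smul_one {κ : Type} [Fintype κ] [DecidableEq κ]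
    (T : Matrix κ κ ℝ) : ∀ᶠ r : ℝ in 𝓝[≠] 0, IsUnit (T + r • (1 : Matrix κ κ ℝ)).det := by
  have hfin : {r : ℝ | (-T).charpoly.IsRoot r}.Finite :=
    Polynomial.finite_setOfPred_isRoot (charpoly_monic _).ne_zero
  have hop : IsOpen ({r : ℝ | (-T).charpoly.IsRoot r} \ {0})ᶜ :=
    (hfin.subset Set.sdiff_subset).isClosed.isOpen_compl
  have hmem : ({r : ℝ | (-T).charpoly.IsRoot r} \ {0})ᶜ ∈ 𝓝 (0 : ℝ) := hop.mem_nhds (by simp)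
  filter_upwards [nhdsWithin_le_nhds hmem, self_mem_nhdsWithin] with r h1 h2
  rw [isUnit_iff_ne_zero]
  intro h3
  refine h1 ⟨?_, h2⟩
  rw [Set.mem_ofPred_eq, Polynomial.IsRoot, eval_charpoly, ← h3, sub_neg_eq_add, add_comm,
    scalar_apply, smul_one_eq_diagonal]

open Filter Topology

theorem isUnit_det_eventually {T κ : Type} [Fintype κ] [DecidableEq κ] [TopologicalSpace T]
    {f : T → Matrix κ κ ℝ} {x : T} (hf : ContinuousAt f x) (h : IsUnit (f x).det) :
    ∀ᶠ t in 𝓝 x, IsUnit (f t).det := by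
  have h1 : ContinuousAt (fun t => (f t).det) x :=
    (continuous_id.matrix_det (A := fun A : Matrix κ κ ℝ => A)).continuousAt.comp hf
  filter_upwards [h1.eventually_ne h.ne_zero] with t ht
  exact isUnit_iff_ne_zero.2 ht

theorem isUnit_det_gram_of_isUnit {ι κ : Type} [Fintype κ] [DecidableEq κ] [Fintype ι]
    [DecidableEq ι] {A : Matrix κ κ ℝ} (hA : Aᵀ = -A)
    {M : Matrix κ ι ℝ} (hM : IsUnit (M * Mᵀ).det) : IsUnit (A + M * Mᵀ).det :=
  isUnit_det_skew_add_gram hA (R := Mᵀ * (M * Mᵀ)⁻¹)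
    (by rw [← Matrix.mul_assoc, mul_nonsing_inv _ hM])

theorem cayleyReflection_mem_closure_of_isUnit_toCols {A : Matrix (Fin m) (Fin m) ℝ}
    (hA : Aᵀ = -A) {M : Matrix (Fin m) (Fin m ⊕ (Fin b ⊕ Fin a)) ℝ}
    {N : Matrix (Fin m ⊕ (Fin b ⊕ Fin a)) (Fin b) ℝ} (hMN : M * N = 0)
    (hM : IsUnit M.toCols₁.det) (hMM : IsUnit (M * Mᵀ).det) (hN : IsUnit (Nᵀ * N).det) :
    cayleyReflection A M N ∈ closure (Set.range (chart (m := m) (b := b) (a := a))) := by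
  -- Moving `N` along `N₀` preserves `M * N = 0` and adds a multiple of the identity to the leading
  -- block.
  set N₀ : Matrix (Fin m ⊕ (Fin b ⊕ Fin a)) (Fin b) ℝ := colFrame (M.toCols₁⁻¹ * M.toCols₂) 0
  have hMN₀ : M * N₀ = 0 := by
    have hM' : M = M.toCols₁ * rowFrame (M.toCols₁⁻¹ * M.toCols₂) := by
      rw [mul_fromCols, Matrix.mul_one, ← Matrix.mul_assoc, mul_nonsing_inv _ hM, Matrix.one_mul,
        fromCols_toCols]
    conv_lhs => rw [hM', Matrix.mul_assoc, rowFrame_mul_colFrame, Matrix.mul_zero]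
  have hc : Continuous fun r : ℝ => N + r • N₀ := by fun_prop
  have hcont : ContinuousAt (fun r : ℝ => cayleyReflection A M (N + r • N₀)) 0 :=
    continuousAt_cayleyReflection continuousAt_const continuousAt_const hc.continuousAt
      (isUnit_det_gram_of_isUnit hA hMM) (by simpa using hN)
  have ht : Tendsto (fun r : ℝ => cayleyReflection A M (N + r • N₀)) (𝓝[≠] 0)
      (𝓝 (cayleyReflection A M N)) := by
    have := hcont.tendsto
    simp only [zero_smul, add_zero] at this
    exact this.mono_left nhdsWithin_le_nhds
  refine mem_closure_of_tendsto ht ?_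
  filter_upwards [eventually_isUnit_det_add_smul_one N.toRows₂.toRows₁] with r hr
  refine cayleyReflection_mem_range_chart hA ?_ hM ?_
  · rw [Matrix.mul_add, hMN, Matrix.mul_smul, hMN₀, smul_zero, add_zero]
  · exact hr

theorem cayleyReflection_mem_closure {A : Matrix (Fin m) (Fin m) ℝ} (hA : Aᵀ = -A)
    {M : Matrix (Fin m) (Fin m ⊕ (Fin b ⊕ Fin a)) ℝ}
    {N : Matrix (Fin m ⊕ (Fin b ⊕ Fin a)) (Fin b) ℝ} (hMN : M * N = 0)
    (hMM : IsUnit (M * Mᵀ).det) (hN : IsUnit (Nᵀ * N).det) :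
    cayleyReflection A M N ∈ closure (Set.range (chart (m := m) (b := b) (a := a))) := by
  set Ms : ℝ → Matrix (Fin m) (Fin m ⊕ (Fin b ⊕ Fin a)) ℝ := fun s => M + s • fromCols 1 0
    with hMs
  -- Once `M` is perturbed, `N` is projected onto the kernel of the new `M` to restore the
  -- orthogonality relation.
  set Ns : ℝ → Matrix (Fin m ⊕ (Fin b ⊕ Fin a)) (Fin b) ℝ := fun s =>
    N - (Ms s)ᵀ * (Ms s * (Ms s)ᵀ)⁻¹ * (Ms s * N) with hNs
  have hM0 : Ms 0 = M := by simp [hMs]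
  have hN0 : Ns 0 = N := by simp only [hNs, hM0, hMN, Matrix.mul_zero, sub_zero]
  have cM : ContinuousAt Ms 0 := by
    have : Continuous Ms := by fun_prop
    exact this.continuousAt
  have cMt := continuousAt_matrix_transpose cM
  have cMM := continuousAt_matrix_mul cM cMt
  have hMM0 : IsUnit (Ms 0 * (Ms 0)ᵀ).det := by rwa [hM0]
  have cN : ContinuousAt Ns 0 := continuousAt_const.sub (continuousAt_matrix_mul
    (continuousAt_matrix_mul cMt (continuousAt_inv_of_isUnit_det cMM hMM0))
    (continuousAt_matrix_mul cM continuousAt_const))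
  have cNN := continuousAt_matrix_mul (continuousAt_matrix_transpose cN) cN
  have hNN0 : IsUnit ((Ns 0)ᵀ * Ns 0).det := by rwa [hN0]
  have ht : Tendsto (fun s => cayleyReflection A (Ms s) (Ns s)) (𝓝[≠] 0)
      (𝓝 (cayleyReflection A M N)) := by
    have := (continuousAt_cayleyReflection (A := fun _ : ℝ => A) continuousAt_const cM cN
      (isUnit_det_gram_of_isUnit hA hMM0) hNN0).tendsto
    rw [hM0, hN0] at this
    exact this.mono_left nhdsWithin_le_nhds
  rw [← closure_closure]
  refine mem_closure_of_tendsto ht ?_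
  filter_upwards [eventually_isUnit_det_add_smul_one M.toCols₁,
    nhdsWithin_le_nhds (isUnit_det_eventually cMM hMM0),
    nhdsWithin_le_nhds (isUnit_det_eventually cNN hNN0)] with s h1 h2 h3
  refine cayleyReflection_mem_closure_of_isUnit_toCols hA ?_ h1 h2 h3
  simp only [hNs]
  rw [Matrix.mul_sub, ← Matrix.mul_assoc (Ms s) ((Ms s)ᵀ * _), ← Matrix.mul_assoc (Ms s) (Ms s)ᵀ,
    mul_nonsing_inv _ h2, Matrix.one_mul, sub_self]

/-- The inverse Cayley transform `A = 2(1 - h)⁻¹ - 1`; it is skew because orthogonality of `h` says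
that `(1 - h)⁻¹` and its transpose sum to `1`. -/
theorem exists_skew_of_isUnit_det_sub_one {κ : Type} [Fintype κ] [DecidableEq κ]
    {h : Matrix κ κ ℝ} (hh : hᵀ * h = 1) (hu : IsUnit (1 - h).det) :
    ∃ A : Matrix κ κ ℝ, Aᵀ = -A ∧ (2 : ℝ) • (A + 1)⁻¹ = 1 - h := by
  have h1 : (1 - h)⁻¹ * (1 - h) = 1 := nonsing_inv_mul _ hu
  have h2 : (1 - h) * (1 - h)⁻¹ = 1 := mul_nonsing_inv _ hu
  have h3 : ((1 - h)⁻¹)ᵀ * (1 - h)ᵀ = 1 := by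
    rw [← transpose_mul, h2, transpose_one]
  have h4 : (1 - h)⁻¹ + ((1 - h)⁻¹)ᵀ = 1 := by
    have h5 : (1 - h)ᵀ * (1 - h) = (1 - h)ᵀ + (1 - h) := by
      rw [transpose_sub, transpose_one, Matrix.sub_mul, Matrix.mul_sub, Matrix.mul_sub, hh]
      simp only [Matrix.one_mul, Matrix.mul_one]
      abel
    have h6 : ((1 - h)⁻¹)ᵀ * ((1 - h)ᵀ * (1 - h)) * (1 - h)⁻¹ = 1 := by
      rw [← Matrix.mul_assoc, h3, Matrix.one_mul, h2]
    rw [h5, Matrix.mul_add, h3, Matrix.add_mul, Matrix.one_mul, Matrix.mul_assoc, h2,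
      Matrix.mul_one] at h6
    exact h6
  refine ⟨(2 : ℝ) • (1 - h)⁻¹ - 1, ?_, ?_⟩
  · have h5 : ((1 - h)⁻¹)ᵀ = 1 - (1 - h)⁻¹ := eq_sub_of_add_eq' h4
    rw [transpose_sub, transpose_smul, transpose_one, h5]
    module
  · have : ((2 : ℝ) • (1 - h)⁻¹)⁻¹ = (1 / 2 : ℝ) • (1 - h) := by
      refine inv_eq_left_inv ?_
      rw [Matrix.smul_mul, Matrix.mul_smul, h2, smul_smul]
      norm_num
    rw [sub_add_cancel, this, smul_smul]
    norm_num

/-- Rotations of an even-dimensional space without the eigenvalue `1` are dense. -/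
theorem mem_closure_isUnit_det_one_sub {κ : Type} [Fintype κ] [DecidableEq κ] {c : ℕ}
    (hκ : Fintype.card κ = 2 * c) {h : Matrix κ κ ℝ} (hh : hᵀ * h = 1) (hd : h.det = 1) :
    h ∈ closure {g : Matrix κ κ ℝ | gᵀ * g = 1 ∧ g.det = 1 ∧ IsUnit (1 - g).det} := by
  obtain ⟨x, y, hx, hy, rfl⟩ := exists_mul_isGrassmannian_of_det_eq_one c hκ hh hd
  have hx' : IsGrassmannian c (-x) := hx.neg (by omega)
  obtain ⟨Q, hQ, hxQ⟩ := hx'.exists_frame (σ := Fin c) (by simp)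
  obtain ⟨R, hR, hyR⟩ := hy.exists_frame (σ := Fin c) (by simp)
  -- Interpolate from the frame `R` of `y` to the frame `Q` of `-x`, which has the same rank because
  -- the space has dimension `2c`. Then `f` runs from `x * y` to `x * (-x) = -1`, where `1 - f` is
  -- invertible.
  set F : (Unit → ℝ) → Matrix κ (Fin c) ℝ := fun t => R + t () • (Q - R) with hF
  set f : (Unit → ℝ) → Matrix κ κ ℝ := fun t =>
    x * -(1 - (2 : ℝ) • (F t * ((F t)ᵀ * F t)⁻¹ * (F t)ᵀ)) with hf
  have hF0 : F 0 = R := by simp [hF]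
  have hF1 : F 1 = Q := by simp [hF]
  have cF : Continuous F := by fun_prop
  have cf : ∀ t, IsUnit ((F t)ᵀ * F t).det → ContinuousAt f t := by
    intro t ht
    have cFt := continuousAt_matrix_transpose (cF.continuousAt (x := t))
    refine continuousAt_matrix_mul continuousAt_const (ContinuousAt.neg
      (continuousAt_const.sub (ContinuousAt.const_smul ?_ (2 : ℝ))))
    exact continuousAt_matrix_mul (continuousAt_matrix_mul cF.continuousAt
      (continuousAt_inv_of_isUnit_det (continuousAt_matrix_mul cFt cF.continuousAt) ht)) cFt
  have u0 : IsUnit ((F 0)ᵀ * F 0).det := by rw [hF0, hR]; simp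
  have u1 : IsUnit ((F 1)ᵀ * F 1).det := by rw [hF1, hQ]; simp
  have hf0 : f 0 = x * y := by
    simp only [hf, hF0, hR, hyR, inv_one, Matrix.mul_one, neg_sub]
  have hf1 : f 1 = -1 := by
    have h1 : f 1 = x * (-x) := by
      simp only [hf, hF1, hQ, hxQ, inv_one, Matrix.mul_one, neg_sub]
    rw [h1, Matrix.mul_neg, hx.sq]
  have rF : MatIsRatIn id F := fun i j =>
    (IsRatIn.const (R i j)).add ((isRat_coord ()).mul (IsRatIn.const ((Q - R) i j)))
  have rf : MatIsRatIn id (fun t => 1 - f t) :=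
    (MatIsRatIn.const 1).sub ((MatIsRatIn.const x).mul ((MatIsRatIn.const 1).sub
      (((rF.mul ((rF.transpose.mul rF).inv isRat_coord)).mul rF.transpose).smul 2)).neg)
  -- A rational function nonzero near `t = 1` is generically nonzero, hence nonzero at parameters
  -- arbitrarily close to `0`.
  have hgen : ∀ᶠ t in genericFilter Unit, (1 - f t).det ≠ 0 := by
    refine (IsRat.dichotomy rf.det).resolve_left fun h0 => ?_
    have h2 : IsUnit (1 - f 1).det := by
      rw [hf1, sub_neg_eq_add, isUnit_iff_ne_zero,
        show (1 : Matrix κ κ ℝ) + 1 = (2 : ℝ) • 1 by module, det_smul]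
      simp
    have h3 := isUnit_det_eventually (continuousAt_const.sub (cf 1 u1)) h2
    have h4 : ∃ᶠ t in 𝓝 (1 : Unit → ℝ), (1 - f t).det = 0 :=
      mem_closure_iff_frequently.1 (dense_of_eventually_genericFilter h0 1)
    obtain ⟨t, h5, h6⟩ := (h4.and_eventually h3).exists
    exact h6.ne_zero h5
  have h4 : ∃ᶠ t in 𝓝 (0 : Unit → ℝ), (1 - f t).det ≠ 0 :=
    mem_closure_iff_frequently.1 (dense_of_eventually_genericFilter hgen 0)
  have h5 := isUnit_det_eventually (continuousAt_matrix_mul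
    (continuousAt_matrix_transpose (cF.continuousAt (x := 0))) cF.continuousAt) u0
  rw [← hf0]
  refine mem_closure_of_frequently_of_tendsto ((h4.and_eventually h5).mono ?_) (cf 0 u0).tendsto
  rintro t ⟨h6, h7⟩
  refine ⟨?_, ?_, isUnit_iff_ne_zero.2 h6⟩
  · simp only [hf]
    rw [transpose_mul, transpose_neg, hx.symm, Matrix.mul_assoc, ← Matrix.mul_assoc x, hx.sq,
      Matrix.one_mul, neg_mul_neg, reflection_orthogonal h7]
  · simp only [hf]
    rw [det_mul, det_neg, reflection_det h7, hx.det, hκ, Fintype.card_fin, pow_add, pow_mul]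
    simp [← mul_pow]

/-- Keep the two eigenframes of `X * Y` and approximate only its rotation block by rotations without
eigenvalue `1`. Each of these is a Cayley transform, so the approximant is a `cayleyReflection`. -/
theorem mem_closure_range_chart {c : ℕ}
    {X Y : Matrix (Fin (2 * c) ⊕ (Fin b ⊕ Fin a)) (Fin (2 * c) ⊕ (Fin b ⊕ Fin a)) ℝ}
    (hX : IsGrassmannian (c + b) X) (hY : IsGrassmannian c Y) :
    X * Y ∈ closure (Set.range (chart (m := 2 * c) (b := b) (a := a))) := by
  obtain ⟨hZ, hdet, ⟨G₂, h2, h2'⟩, G₃, h3, h3'⟩ :=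
    IsGrassmannian.mul_eigenspaces (α := Fin a) (β := Fin b) (by simpa using hX) hY
      (by simp; omega)
  obtain ⟨G₁, h, hG, hPG, hP, hs, hh, hd, hdec⟩ :=
    exists_adapted_frame (κ := Fin (2 * c)) hZ hdet (by simp; omega) h2 h3 h2' h3'
  set W := fromCols G₂ G₃ * Matrix.fromBlocks (1 : Matrix (Fin a) (Fin a) ℝ) 0 0
    (-1 : Matrix (Fin b) (Fin b) ℝ) * (fromCols G₂ G₃)ᵀ with hW
  have hWe : W = 1 - G₁ * G₁ᵀ - (2 : ℝ) • (G₃ * G₃ᵀ) := by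
    rw [← hs, hW, fromCols_mul_fromBlocks_mul_transpose, transpose_fromCols,
      fromCols_mul_fromRows]
    simp only [Matrix.mul_one, Matrix.mul_neg, Matrix.neg_mul]
    module
  have hG3 : G₁ᵀ * G₃ = 0 := by
    rw [transpose_fromCols, fromRows_mul] at hPG
    have := congrArg toRows₂ hPG
    rw [toRows₂_fromRows] at this
    simpa using congrArg Matrix.transpose (this.trans (b := (0 : Matrix _ _ ℝ)) rfl)
  have hcont : Continuous fun g : Matrix (Fin (2 * c)) (Fin (2 * c)) ℝ => W + G₁ * g * G₁ᵀ :=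
    continuous_const.add ((continuous_const.matrix_mul continuous_id).matrix_mul continuous_const)
  rw [hdec, ← closure_closure]
  refine map_mem_closure (f := fun g : Matrix (Fin (2 * c)) (Fin (2 * c)) ℝ => W + G₁ * g * G₁ᵀ)
    hcont (mem_closure_isUnit_det_one_sub (c := c) (by simp) hh hd) ?_
  rintro g ⟨hg, -, hgu⟩
  obtain ⟨A, hA, hAg⟩ := exists_skew_of_isUnit_det_sub_one hg hgu
  have : W + G₁ * g * G₁ᵀ = cayleyReflection A G₁ᵀ G₃ := by
    have hg' : g = 1 - (2 : ℝ) • (A + 1)⁻¹ := by rw [hAg]; abel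
    rw [cayleyReflection, transpose_transpose, hG, h3, inv_one, hWe, hg']
    simp only [Matrix.mul_one, Matrix.mul_sub, Matrix.sub_mul, Matrix.mul_smul, Matrix.smul_mul]
    module
  simp only [this]
  exact cayleyReflection_mem_closure hA hG3 (by rw [transpose_transpose, hG]; simp)
    (by rw [h3]; simp)

end Closure

end Chart

/-! ### Inverting the chart and counting parameters -/

section Dimension

open Matrix

theorem MatIsRatIn.fromRows {τ ι m m' n : Type} {φ : (τ → ℝ) → ι → ℝ}
    {A : (τ → ℝ) → Matrix m n ℝ} {B : (τ → ℝ) → Matrix m' n ℝ} (hA : MatIsRatIn φ A)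
    (hB : MatIsRatIn φ B) : MatIsRatIn φ (fun t => Matrix.fromRows (A t) (B t)) := fun i j => by
  rcases i with i | i
  · exact hA i j
  · exact hB i j

theorem MatIsRatIn.fromCols {τ ι m n n' : Type} {φ : (τ → ℝ) → ι → ℝ}
    {A : (τ → ℝ) → Matrix m n ℝ} {B : (τ → ℝ) → Matrix m n' ℝ} (hA : MatIsRatIn φ A)
    (hB : MatIsRatIn φ B) : MatIsRatIn φ (fun t => Matrix.fromCols (A t) (B t)) := fun i j => by
  rcases j with j | j
  · exact hA i j
  · exact hB i j

variable {m b a : ℕ}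

theorem skewCoord_isRat : MatIsRatIn id (skewCoord (m := m) (b := b) (a := a)) := by
  intro i j
  rcases lt_trichotomy i j with h | h | h
  · simpa [skewCoord, h] using isRat_coord _
  · simpa [skewCoord, h] using IsRatIn.const 0
  · simpa [skewCoord, h, h.not_gt] using (isRat_coord _).neg

theorem chart_isRat : MatIsRatIn id (chart (m := m) (b := b) (a := a)) := by
  have hC : MatIsRatIn id (rowCoord (m := m) (b := b) (a := a)) := fun i j => isRat_coord _
  have hD : MatIsRatIn id (colCoord (m := m) (b := b) (a := a)) := fun i j => isRat_coord _
  have hM : MatIsRatIn id fun t : ChartIndex m b a → ℝ => rowFrame (rowCoord t) :=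
    (MatIsRatIn.const _).fromCols hC
  have hL : MatIsRatIn id fun t : ChartIndex m b a → ℝ => lowerFrame (colCoord t) :=
    (MatIsRatIn.const _).fromRows hD
  have hN : MatIsRatIn id fun t : ChartIndex m b a → ℝ => colFrame (rowCoord t) (colCoord t) :=
    (hC.mul hL).neg.fromRows hL
  exact ((MatIsRatIn.const 1).sub (((hM.transpose.mul ((skewCoord_isRat.add
    (hM.mul hM.transpose)).inv isRat_coord)).mul hM).smul 2)).sub
    (((hN.mul ((hN.transpose.mul hN).inv isRat_coord)).mul hN.transpose).smul 2)

/-- The even size matters: the standard symplectic matrix is an invertible skew matrix, so the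
determinant is not generically zero. -/
theorem eventually_isUnit_det_skewCoord {c : ℕ} :
    ∀ᶠ t in genericFilter (ChartIndex (2 * c) b a), IsUnit (skewCoord t).det := by
  have hd := IsRat.dichotomy (skewCoord_isRat (m := 2 * c) (b := b) (a := a)).det
  refine (hd.resolve_left fun h0 => ?_).mono fun t ht => isUnit_iff_ne_zero.2 ht
  have hcl : IsClosed {t : ChartIndex (2 * c) b a → ℝ | (skewCoord t).det = 0} :=
    isClosed_eq continuous_skewCoord.matrix_det continuous_const
  let e : Fin c ⊕ Fin c ≃ Fin (2 * c) := finSumFinEquiv.trans (finCongr (two_mul c).symm)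
  obtain ⟨t, ht, -, -⟩ := exists_coord (b := b) (a := a)
    (A := reindex e e (J (Fin c) ℝ)) (by
      rw [transpose_reindex, J_transpose]; rfl) 0 0
  have h1 := dense_of_eventually_genericFilter h0 t
  rw [hcl.closure_eq] at h1
  have h2 : (skewCoord t).det = 0 := h1
  rw [ht, det_reindex_self] at h2
  exact (isUnit_det_J (Fin c) ℝ).ne_zero h2

theorem transpose_rowFrame_mul_mul (C : Matrix (Fin m) (Fin b ⊕ Fin a) ℝ)
    (K : Matrix (Fin m) (Fin m) ℝ) :
    (rowFrame C)ᵀ * K * rowFrame C = Matrix.fromBlocks K (K * C) (Cᵀ * K) (Cᵀ * K * C) := by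
  rw [transpose_fromCols, fromRows_mul, fromRows_mul_fromCols]
  simp

/-- The reflection part is symmetric and cancels. What remains comes from `K - Kᵀ = -2 KᵀAK`, which
is invertible together with `A`. -/
theorem chart_sub_transpose (t : ChartIndex m b a → ℝ) :
    ∃ L : Matrix (Fin m) (Fin m) ℝ, (IsUnit (skewCoord t).det → IsUnit L.det) ∧
      chart t - (chart t)ᵀ = (rowFrame (rowCoord t))ᵀ * L * rowFrame (rowCoord t) := by
  set M := rowFrame (rowCoord t)
  set A := skewCoord t
  set K := (A + M * Mᵀ)⁻¹ with hK
  have hu : IsUnit (A + M * Mᵀ).det := isUnit_det_chart t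
  have hsub := inv_sub_transpose_inv (skewCoord_transpose t) (B := M * Mᵀ) (by simp) hu
  have hKu : IsUnit K.det := isUnit_nonsing_inv_det _ hu
  refine ⟨-(2 : ℝ) • (K - Kᵀ), fun hA => ?_, ?_⟩
  · rw [hsub, det_smul, det_smul, det_mul, det_mul, det_transpose]
    refine IsUnit.mul (by simp) (IsUnit.mul (by simp) ?_)
    exact (hKu.mul hA).mul hKu
  · simp only [chart, cayleyReflection, transpose_sub, transpose_smul, transpose_mul,
      transpose_one, transpose_transpose, transpose_nonsing_inv]
    rw [show ((skewCoord t) + rowFrame (rowCoord t) * (rowFrame (rowCoord t))ᵀ)⁻¹ = K from rfl,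
      show ((skewCoord t) + rowFrame (rowCoord t) * (rowFrame (rowCoord t))ᵀ)ᵀ⁻¹ = Kᵀ by
        rw [hK, transpose_nonsing_inv]]
    simp only [Matrix.mul_sub, Matrix.sub_mul, Matrix.mul_smul, Matrix.smul_mul, Matrix.mul_assoc]
    module

/-- The second factor projects onto the orthogonal complement of the rows of `M`: it kills the
Cayley part and preserves the part from `N`. -/
theorem one_sub_chart_mul (t : ChartIndex m b a → ℝ) :
    (1 - chart t) * (1 - (rowFrame (rowCoord t))ᵀ * (rowFrame (rowCoord t) *
      (rowFrame (rowCoord t))ᵀ)⁻¹ * rowFrame (rowCoord t)) =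
    (2 : ℝ) • (colFrame (rowCoord t) (colCoord t) * ((colFrame (rowCoord t) (colCoord t))ᵀ *
      colFrame (rowCoord t) (colCoord t))⁻¹ * (colFrame (rowCoord t) (colCoord t))ᵀ) := by
  have hMN := rowFrame_mul_colFrame (rowCoord t) (colCoord t)
  have hMM := isUnit_det_rowFrame (rowCoord t)
  rw [chart, cayleyReflection]
  set M := rowFrame (rowCoord t)
  set N := colFrame (rowCoord t) (colCoord t)
  set Q := 1 - Mᵀ * (M * Mᵀ)⁻¹ * M with hQ
  have hNM : Nᵀ * Mᵀ = 0 := by rw [← transpose_mul, hMN, transpose_zero]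
  have h1 : M * Q = 0 := by
    rw [hQ, Matrix.mul_sub, ← Matrix.mul_assoc, ← Matrix.mul_assoc, mul_nonsing_inv _ hMM]
    simp
  have h2 : Nᵀ * Q = Nᵀ := by
    rw [hQ, Matrix.mul_sub, ← Matrix.mul_assoc, ← Matrix.mul_assoc, hNM]
    simp
  have h3 : ∀ U V : Matrix (Fin m ⊕ (Fin b ⊕ Fin a)) (Fin m ⊕ (Fin b ⊕ Fin a)) ℝ,
      1 - (1 - (2 : ℝ) • U - (2 : ℝ) • V) = (2 : ℝ) • U + (2 : ℝ) • V := fun U V => by abel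
  rw [h3, Matrix.add_mul, Matrix.smul_mul, Matrix.smul_mul, Matrix.mul_assoc _ M, h1,
    Matrix.mul_assoc _ Nᵀ, h2]
  simp

/-! ### Parameters as rational functions of the matrix -/

section Recovery

variable {c : ℕ} {ι : Type} {φ : (ChartIndex (2 * c) b a → ℝ) → ι → ℝ}

/-- With `C` the row coordinates, the upper blocks of `Z - Zᵀ` are `L` and `L * C`, and `L` is
generically invertible. -/
theorem rowCoord_isRatIn (hφ : ∀ i, IsRat fun t => φ t i) (hZ : MatIsRatIn φ chart) :
    MatIsRatIn φ rowCoord := by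
  have hL := hZ.sub hZ.transpose
  refine (((hL.submatrix Sum.inl Sum.inl).inv hφ).mul (hL.submatrix Sum.inl Sum.inr)).congr ?_
  filter_upwards [eventually_isUnit_det_skewCoord] with t ht
  obtain ⟨L, hLu, h⟩ := chart_sub_transpose t
  rw [h, transpose_rowFrame_mul_mul]
  change _ = L⁻¹ * (L * rowCoord t)
  rw [← Matrix.mul_assoc, nonsing_inv_mul _ (hLu ht), Matrix.one_mul]

/-- The projection to the `-1`-eigenspace is a rational function of the matrix. -/
theorem projection_isRatIn (hφ : ∀ i, IsRat fun t => φ t i) (hZ : MatIsRatIn φ chart) :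
    MatIsRatIn φ fun t => colFrame (rowCoord t) (colCoord t) *
      ((colFrame (rowCoord t) (colCoord t))ᵀ * colFrame (rowCoord t) (colCoord t))⁻¹ *
        (colFrame (rowCoord t) (colCoord t))ᵀ := by
  have hM : MatIsRatIn φ fun t : ChartIndex (2 * c) b a → ℝ => rowFrame (rowCoord t) :=
    (MatIsRatIn.const _).fromCols (rowCoord_isRatIn hφ hZ)
  refine ((((MatIsRatIn.const 1).sub hZ).mul ((MatIsRatIn.const 1).sub ((hM.transpose.mul
    ((hM.mul hM.transpose).inv hφ)).mul hM))).smul (1 / 2)).congr ?_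
  filter_upwards with t
  rw [one_sub_chart_mul, smul_smul]
  norm_num

/-- As the lower part of the column frame is `(1, D)`, the projection contains the blocks `G` and `D
* G` with `G` invertible. -/
theorem colCoord_isRatIn (hφ : ∀ i, IsRat fun t => φ t i) (hZ : MatIsRatIn φ chart) :
    MatIsRatIn φ colCoord := by
  have hP := projection_isRatIn hφ hZ
  refine ((hP.submatrix (fun i => Sum.inr (Sum.inr i)) (fun i => Sum.inr (Sum.inl i))).mul
    ((hP.submatrix (fun i => Sum.inr (Sum.inl i))
      (fun i => Sum.inr (Sum.inl i))).inv hφ)).congr ?_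
  filter_upwards with t
  have hu := isUnit_det_colFrame (rowCoord t) (colCoord t)
  set G := ((colFrame (rowCoord t) (colCoord t))ᵀ * colFrame (rowCoord t) (colCoord t))⁻¹
  have hG : IsUnit G.det := isUnit_nonsing_inv_det _ hu
  have h : ∀ C : Matrix (Fin (2 * c)) (Fin b ⊕ Fin a) ℝ, ∀ D : Matrix (Fin a) (Fin b) ℝ,
      (colFrame C D * G * (colFrame C D)ᵀ).submatrix (fun i => Sum.inr (Sum.inr i))
        (fun i => Sum.inr (Sum.inl i)) = D * G ∧
      (colFrame C D * G * (colFrame C D)ᵀ).submatrix (fun i => Sum.inr (Sum.inl i))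
        (fun i => Sum.inr (Sum.inl i)) = G := by
    intro C D
    constructor
    · change D * G * (1 : Matrix (Fin b) (Fin b) ℝ)ᵀ = D * G
      rw [transpose_one, Matrix.mul_one]
    · change (1 : Matrix (Fin b) (Fin b) ℝ) * G * (1 : Matrix (Fin b) (Fin b) ℝ)ᵀ = G
      rw [transpose_one, Matrix.mul_one, Matrix.one_mul]
  rw [(h _ _).1, (h _ _).2, Matrix.mul_assoc, mul_nonsing_inv _ hG, Matrix.mul_one]

/-- Removing the projection from `(1 - Z)/2` leaves `MᵀKM`, whose leading block is `K = (A +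
MMᵀ)⁻¹`; invert it and subtract `MMᵀ`. -/
theorem skewCoord_isRatIn (hφ : ∀ i, IsRat fun t => φ t i) (hZ : MatIsRatIn φ chart) :
    MatIsRatIn φ skewCoord := by
  have hM : MatIsRatIn φ fun t : ChartIndex (2 * c) b a → ℝ => rowFrame (rowCoord t) :=
    (MatIsRatIn.const _).fromCols (rowCoord_isRatIn hφ hZ)
  have hP := projection_isRatIn hφ hZ
  have hK := ((((MatIsRatIn.const 1).sub hZ).smul (1 / 2)).sub hP).submatrix Sum.inl Sum.inl
  refine ((hK.inv hφ).sub (hM.mul hM.transpose)).congr ?_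
  filter_upwards with t
  have hu := isUnit_det_chart t
  have h1 : (1 / 2 : ℝ) • (1 - chart t) - colFrame (rowCoord t) (colCoord t) *
      ((colFrame (rowCoord t) (colCoord t))ᵀ * colFrame (rowCoord t) (colCoord t))⁻¹ *
        (colFrame (rowCoord t) (colCoord t))ᵀ = (rowFrame (rowCoord t))ᵀ *
        (skewCoord t + rowFrame (rowCoord t) * (rowFrame (rowCoord t))ᵀ)⁻¹ *
          rowFrame (rowCoord t) := by
    rw [chart, cayleyReflection]
    module
  rw [h1, transpose_rowFrame_mul_mul]
  change _ = (skewCoord t + rowFrame (rowCoord t) * (rowFrame (rowCoord t))ᵀ)⁻¹⁻¹ - _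
  rw [nonsing_inv_nonsing_inv _ hu, add_sub_cancel_right]

theorem coord_isRatIn (hφ : ∀ i, IsRat fun t => φ t i) (hZ : MatIsRatIn φ chart)
    (j : ChartIndex (2 * c) b a) : IsRatIn φ fun t => t j := by
  rcases j with ⟨⟨i, j⟩, h⟩ | ⟨i, j⟩ | ⟨i, j⟩
  · refine (skewCoord_isRatIn hφ hZ i j).congr (Filter.Eventually.of_forall fun t => ?_)
    have h' : i < j := h
    simp [skewCoord, h']
  · exact rowCoord_isRatIn hφ hZ i j
  · exact colCoord_isRatIn hφ hZ i j

end Recovery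

theorem card_lt_pairs (m : ℕ) :
    Fintype.card {p : Fin m × Fin m // p.1 < p.2} * 2 = m * (m - 1) := by
  have e : {p : Fin m × Fin m // p.1 < p.2} ≃ Σ j : Fin m, {i : Fin m // i < j} :=
    { toFun := fun p => ⟨p.1.2, p.1.1, p.2⟩
      invFun := fun q => ⟨(q.2.1, q.1), q.2.2⟩
      left_inv := fun _ => rfl
      right_inv := fun _ => rfl }
  rw [Fintype.card_congr e, Fintype.card_sigma]
  have : ∀ j : Fin m, Fintype.card {i : Fin m // i < j} = (j : ℕ) := fun j => by
    rw [Fintype.card_subtype, ← Fin.card_Iio j]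
    congr 1
    ext; simp
  rw [Finset.sum_congr rfl fun j _ => this j, Fin.sum_univ_eq_sum_range (fun i => i) m,
    Finset.sum_range_id_mul_two]

theorem IsGrassmannian.reindex {ι κ : Type} [Fintype ι] [DecidableEq ι] [Fintype κ]
    [DecidableEq κ] (e : ι ≃ κ) {k : ℕ} {X : Matrix ι ι ℝ} (hX : IsGrassmannian k X) :
    IsGrassmannian k (X.submatrix e.symm e.symm) := by
  refine ⟨by rw [transpose_submatrix, hX.symm], ?_, ?_⟩
  · rw [submatrix_mul_equiv, hX.sq, submatrix_one_equiv]
  · rw [← Fintype.card_congr e, ← hX.trace]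
    exact e.symm.sum_comp fun i => X i i

theorem mem_prodGr_iff {k k' n : ℕ} {Z : Matrix (Fin n) (Fin n) ℝ} :
    Z ∈ prodGr k k' n ↔ ∃ X Y, IsGrassmannian k X ∧ IsGrassmannian k' Y ∧ Z = X * Y := by
  simp only [prodGr, Set.mem_ofPred_eq, mem_realGr_iff]
  constructor
  · rintro ⟨X, hX, Y, hY, h⟩
    exact ⟨X, Y, hX, hY, h⟩
  · rintro ⟨X, Y, hX, hY, h⟩
    exact ⟨X, hX, Y, hY, h⟩

theorem realDim_prodGr_eq_card (c b a : ℕ) :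
    realDim (prodGr (c + b) c (2 * c + (b + a))) = Fintype.card (ChartIndex (2 * c) b a) := by
  let e : Fin (2 * c) ⊕ (Fin b ⊕ Fin a) ≃ Fin (2 * c + (b + a)) :=
    (Equiv.sumCongr (Equiv.refl _) finSumFinEquiv).trans finSumFinEquiv
  let φ : (ChartIndex (2 * c) b a → ℝ) →
      Fin (2 * c + (b + a)) × Fin (2 * c + (b + a)) → ℝ :=
    fun t p => chart t (e.symm p.1) (e.symm p.2)
  have hφ : ∀ i, IsRat fun t => φ t i := fun i => chart_isRat _ _
  have hZ : MatIsRatIn φ chart := fun i j => by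
    have := IsRatIn.coord (φ := φ) (e i, e j)
    simpa [φ] using this
  refine ringKrullDim_quotient_vanishingIdeal_eq_card (φ := φ) ?_ hφ (coord_isRatIn hφ hZ) ?_ ?_
  · exact continuous_pi fun p => continuous_chart.matrix_elem _ _
  · rintro _ ⟨t, rfl⟩
    obtain ⟨X, Y, hX, hY, h⟩ := chart_mem t
    refine ⟨(chart t).submatrix e.symm e.symm, ?_, rfl⟩
    rw [mem_prodGr_iff]
    exact ⟨_, _, hX.reindex e, hY.reindex e, by rw [h, submatrix_mul_equiv]⟩
  · rintro _ ⟨Z, hZ, rfl⟩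
    obtain ⟨X, Y, hX, hY, rfl⟩ := mem_prodGr_iff.1 hZ
    have h1 := mem_closure_range_chart (b := b) (a := a) (hX.reindex e.symm) (hY.reindex e.symm)
    rw [submatrix_mul_equiv] at h1
    have hc : Continuous fun (W : Matrix (Fin (2 * c) ⊕ (Fin b ⊕ Fin a))
        (Fin (2 * c) ⊕ (Fin b ⊕ Fin a)) ℝ)
        (p : Fin (2 * c + (b + a)) × Fin (2 * c + (b + a))) => W (e.symm p.1) (e.symm p.2) :=
      continuous_pi fun p => continuous_id.matrix_elem _ _
    have h2 := map_mem_closure hc h1 (t := Set.range φ) (by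
      rintro _ ⟨t, rfl⟩
      exact ⟨t, rfl⟩)
    convert! h2 using 1
    ext p
    simp

theorem card_chartIndex (c b a : ℕ) :
    Fintype.card (ChartIndex (2 * c) b a) + c =
      2 * c * c + 2 * c * (b + a) + a * b := by
  have h := card_lt_pairs (2 * c)
  rw [Fintype.card_sum, Fintype.card_sum, Fintype.card_prod, Fintype.card_prod, Fintype.card_sum]
  simp only [Fintype.card_fin]
  rcases c with _ | c
  · simp at h ⊢
  · have h2 : 2 * (c + 1) - 1 = 2 * c + 1 := by omega
    rw [h2] at h
    nlinarith

end Dimension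

/-! ### Comparison with the components of the orthogonal group -/

section Main

open Matrix

variable {ι : Type} [Fintype ι] [DecidableEq ι]

/-- The empty set would have the zero ring as coordinate ring, of Krull dimension `⊥`, while the
dimension is a natural number. -/
theorem prodGr_nonempty (c b a : ℕ) : (prodGr (c + b) c (2 * c + (b + a))).Nonempty := by
  by_contra h
  rw [Set.not_nonempty_iff_eq_empty] at h
  have h1 := realDim_prodGr_eq_card c b a
  have h2 : matrixVanishingIdeal (∅ : Set (Matrix (Fin (2 * c + (b + a)))
      (Fin (2 * c + (b + a))) ℝ)) = ⊤ := by
    rw [matrixVanishingIdeal, Set.image_empty, MvPolynomial.vanishingIdeal_empty]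
  rw [h, realDim, h2] at h1
  have h3 : Subsingleton (MvPolynomial (Fin (2 * c + (b + a)) × Fin (2 * c + (b + a))) ℝ ⧸
      (⊤ : Ideal (MvPolynomial (Fin (2 * c + (b + a)) × Fin (2 * c + (b + a))) ℝ))) :=
    Ideal.Quotient.subsingleton_iff.2 rfl
  rw [ringKrullDim_eq_bot_of_subsingleton] at h1
  exact WithBot.bot_ne_coe (a := ((Fintype.card (ChartIndex (2 * c) b a) : ℕ) : ℕ∞)) h1

theorem orthogonal_of_mem_prodGr {c b a : ℕ}
    {Z : Matrix (Fin (2 * c + (b + a))) (Fin (2 * c + (b + a))) ℝ}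
    (hZ : Z ∈ prodGr (c + b) c (2 * c + (b + a))) :
    Z ∈ orthogonalGroup (Fin (2 * c + (b + a))) ℝ ∧ Z.det = (-1) ^ b := by
  obtain ⟨X, Y, hX, hY, rfl⟩ := mem_prodGr_iff.1 hZ
  obtain ⟨h1, h2, -⟩ := IsGrassmannian.mul_eigenspaces (β := Fin b) (α := Fin a)
    (by simpa using hX) hY (by simp; omega)
  rw [Fintype.card_fin] at h2
  exact ⟨(mem_orthogonalGroup_iff' _ _).2 h1, h2⟩

theorem mem_prodGr_of_frames {c b a : ℕ}
    {Z : Matrix (Fin (2 * c + (b + a))) (Fin (2 * c + (b + a))) ℝ}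
    (hZ : Z ∈ orthogonalGroup (Fin (2 * c + (b + a))) ℝ) (hd : Z.det = (-1) ^ b)
    (h2 : ∃ G : Matrix (Fin (2 * c + (b + a))) (Fin a) ℝ, Gᵀ * G = 1 ∧ Z * G = (1 : ℝ) • G)
    (h3 : ∃ G : Matrix (Fin (2 * c + (b + a))) (Fin b) ℝ, Gᵀ * G = 1 ∧ Z * G = (-1 : ℝ) • G) :
    Z ∈ prodGr (c + b) c (2 * c + (b + a)) := by
  obtain ⟨G₂, h2, h2'⟩ := h2
  obtain ⟨G₃, h3, h3'⟩ := h3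
  rw [one_smul] at h2'
  rw [neg_one_smul] at h3'
  have := exists_mul_isGrassmannian (c := c) ((mem_orthogonalGroup_iff' _ _).1 hZ)
    (by rw [Fintype.card_fin, hd]) (by simp; omega) h2 h3 h2' h3'
  rw [Fintype.card_fin] at this
  exact mem_prodGr_iff.2 this

theorem exists_frame_fin_zero (Z : Matrix ι ι ℝ) (s : ℝ) :
    ∃ G : Matrix ι (Fin 0) ℝ, Gᵀ * G = 1 ∧ Z * G = s • G :=
  ⟨0, Subsingleton.elim _ _, Subsingleton.elim _ _⟩

theorem exists_frame_fin_one {Z : Matrix ι ι ℝ} (hZ : Z ∈ orthogonalGroup ι ℝ) {s : ℝ}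
    (hs : s * s = 1) (hd : Z.det * (-s) ^ Fintype.card ι = -1) :
    ∃ G : Matrix ι (Fin 1) ℝ, Gᵀ * G = 1 ∧ Z * G = s • G := by
  obtain ⟨v, hv, h⟩ := exists_unit_mulVec_eq_zero
    (det_sub_eq_zero_of_orthogonal ((mem_orthogonalGroup_iff' _ _).1 hZ) hs hd)
  rw [sub_mulVec, smul_mulVec, one_mulVec, sub_eq_zero] at h
  refine ⟨Matrix.of fun i _ => v i, ?_, ?_⟩
  · ext i j
    obtain rfl : i = j := Subsingleton.elim _ _
    simpa [mul_apply, dotProduct] using hv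
  · ext i j
    simpa [mul_apply, mulVec, dotProduct] using congrFun h i

/-- No eigenvalue `-1` is required, and `a = 1` means odd dimension, where every rotation fixes a
vector. -/
theorem prodGr_eq_setSO {c a : ℕ} (ha : a ≤ 1) :
    prodGr (c + 0) c (2 * c + (0 + a)) = setSO (2 * c + (0 + a)) := by
  ext Z
  constructor
  · intro h
    have := orthogonal_of_mem_prodGr h
    exact ⟨this.1, by simpa using this.2⟩
  · rintro ⟨hZ, hd⟩
    refine mem_prodGr_of_frames hZ (by simpa using hd) ?_ (exists_frame_fin_zero _ _)
    interval_cases a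
    · exact exists_frame_fin_zero _ _
    · refine exists_frame_fin_one hZ (by norm_num) ?_
      rw [hd, Fintype.card_fin, zero_add, pow_succ, pow_mul]
      norm_num

/-- Determinant `-1` always forces the eigenvalue `-1`; in even dimension, the case `a = 1`, it also
forces the eigenvalue `1`. -/
theorem prodGr_eq_setSOMinus {c a : ℕ} (ha : a ≤ 1) :
    prodGr (c + 1) c (2 * c + (1 + a)) = setSOMinus (2 * c + (1 + a)) := by
  ext Z
  constructor
  · intro h
    have := orthogonal_of_mem_prodGr h
    exact ⟨this.1, by simpa using this.2⟩
  · rintro ⟨hZ, hd⟩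
    refine mem_prodGr_of_frames hZ (by simpa using hd) ?_
      (exists_frame_fin_one hZ (by norm_num) (by rw [hd]; norm_num))
    interval_cases a
    · exact exists_frame_fin_zero _ _
    · refine exists_frame_fin_one hZ (by norm_num) ?_
      rw [hd, Fintype.card_fin, pow_add, pow_mul]
      norm_num

/-- The defect formula `n(n-1) - 2 dim = a(a-1) + b(b-1)`, written without subtraction. -/
theorem two_mul_card_chartIndex (c b a : ℕ) :
    2 * Fintype.card (ChartIndex (2 * c) b a) + a * a + b * b + (2 * c + (b + a)) =
      (2 * c + (b + a)) * (2 * c + (b + a)) + a + b := by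
  have := card_chartIndex c b a
  nlinarith

/-- No separate computation is needed: this is the product set with `b = 0` and `a = n % 2`, whose
defect is zero. -/
theorem realDim_setSO (n : ℕ) : ∃ d : ℕ, realDim (setSO n) = d ∧ 2 * d + n = n * n := by
  obtain ⟨c, a, ha, rfl⟩ : ∃ c a, a ≤ 1 ∧ n = 2 * c + (0 + a) :=
    ⟨n / 2, n % 2, by omega, by omega⟩
  refine ⟨_, by rw [← prodGr_eq_setSO ha, realDim_prodGr_eq_card], ?_⟩
  have h := two_mul_card_chartIndex c 0 a
  have : a * a = a := by interval_cases a <;> rfl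
  omega

theorem realDim_setSOMinus {n : ℕ} (hn : 1 ≤ n) :
    ∃ d : ℕ, realDim (setSOMinus n) = d ∧ 2 * d + n = n * n := by
  obtain ⟨c, a, ha, rfl⟩ : ∃ c a, a ≤ 1 ∧ n = 2 * c + (1 + a) :=
    ⟨(n - 1) / 2, (n - 1) % 2, by omega, by omega⟩
  refine ⟨_, by rw [← prodGr_eq_setSOMinus ha, realDim_prodGr_eq_card], ?_⟩
  have h := two_mul_card_chartIndex c 1 a
  have : a * a = a := by interval_cases a <;> rfl
  omega

theorem le_one_of_realDim_prodGr_eq {c b a d : ℕ}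
    (h : realDim (prodGr (c + b) c (2 * c + (b + a))) = d)
    (hd : 2 * d + (2 * c + (b + a)) = (2 * c + (b + a)) * (2 * c + (b + a))) :
    a ≤ 1 ∧ b ≤ 1 := by
  rw [realDim_prodGr_eq_card] at h
  have h1 : Fintype.card (ChartIndex (2 * c) b a) = d := by exact_mod_cast h
  have h2 := two_mul_card_chartIndex c b a
  rw [h1] at h2
  have h3 : a * a + b * b = a + b := by omega
  constructor
  · by_contra! h4
    nlinarith [Nat.le_mul_self b]
  · by_contra! h4
    nlinarith [Nat.le_mul_self a]

theorem setSO_eq_mul_realGr (n : ℕ) : setSO n = realGr (n / 2) n * realGr (n / 2) n := by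
  obtain ⟨c, a, ha, rfl⟩ : ∃ c a, a ≤ 1 ∧ n = 2 * c + (0 + a) :=
    ⟨n / 2, n % 2, by omega, by omega⟩
  rw [show (2 * c + (0 + a)) / 2 = c by omega, ← prodGr_eq_setSO ha]
  ext Z
  simp only [prodGr, Set.mem_ofPred_eq, Set.mem_mul, add_zero, eq_comm (a := Z)]

end Main

theorem theorem2p7 :
    (∀ k k' n : ℕ, k' ≤ k → k < n → k + k' ≤ n →
      realDim (prodGr k k' n) = ((k * (n - k) + k' * (n - k') - k' : ℕ) : WithBot ℕ∞) ∧
      (prodGr k k' n = setSO n ↔ k = k' ∧ (n = 2 * k ∨ n = 2 * k + 1)) ∧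
      (prodGr k k' n = setSOMinus n ↔ k = k' + 1 ∧ (n = 2 * k - 1 ∨ n = 2 * k))) ∧
    (∀ n : ℕ, 1 ≤ n → setSO n = realGr (n / 2) n * realGr (n / 2) n) := by
  refine ⟨?_, fun n _ => setSO_eq_mul_realGr n⟩
  intro k c n hk hkn hle
  -- Set `b = k - k'` and `a = n - k - k'`.
  obtain ⟨b, rfl⟩ := Nat.exists_eq_add_of_le hk
  obtain ⟨a, rfl⟩ : ∃ a, n = 2 * c + (b + a) := ⟨n - (2 * c + b), by omega⟩
  refine ⟨?_, ⟨fun h => ?_, ?_⟩, ⟨fun h => ?_, ?_⟩⟩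
  · rw [realDim_prodGr_eq_card]
    congr 1
    have h1 := card_chartIndex c b a
    rw [show 2 * c + (b + a) - (c + b) = c + a by omega,
      show 2 * c + (b + a) - c = c + b + a by omega]
    have h2 : (c + b) * (c + a) + c * (c + b + a) = 2 * c * c + 2 * c * (b + a) + a * b := by
      ring
    omega
  · obtain ⟨d, hd, hd'⟩ := realDim_setSO (2 * c + (b + a))
    obtain ⟨ha, hb⟩ := le_one_of_realDim_prodGr_eq (h ▸ hd) hd'
    -- The dimension leaves `b = 0` or `b = 1`; the determinant of any one point decides between
    -- them.
    obtain ⟨Z, hZ⟩ := prodGr_nonempty c b a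
    have h1 := (orthogonal_of_mem_prodGr hZ).2
    rw [h] at hZ
    rw [hZ.2] at h1
    interval_cases b
    · omega
    · norm_num at h1
  · rintro ⟨h1, h2⟩
    obtain rfl : b = 0 := by omega
    exact prodGr_eq_setSO (by omega)
  · obtain ⟨d, hd, hd'⟩ := realDim_setSOMinus (n := 2 * c + (b + a)) (by omega)
    obtain ⟨ha, hb⟩ := le_one_of_realDim_prodGr_eq (h ▸ hd) hd'
    obtain ⟨Z, hZ⟩ := prodGr_nonempty c b a
    have h1 := (orthogonal_of_mem_prodGr hZ).2
    rw [h] at hZ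
    rw [hZ.2] at h1
    interval_cases b
    · norm_num at h1
    · omega
  · rintro ⟨h1, h2⟩
    obtain rfl : b = 1 := by omega
    exact prodGr_eq_setSOMinus (by omega)
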